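/- Let $(X,d_X)$ be a countable discrete metric space. **Conventions.** Two metrics $d,b$ on a set $Z$ are *coarsely equivalent* if there is a homeomorphism $\varphi$ of $[0,\infty)$ with $\varphi^{-1}(b(x,y))\le d(x,y)\le\varphi(b(x,y))$ for all $x,y\in Z$; $[d_X]$ denotes the set of metrics on $X$ coarsely equivalent to $d_X$. For a metric $b$ on $X$, the uniform Roe algebra $C^*_u(X,b)\subset\mathbb B(\ell^2(X))$ is the norm closure of the bounded operators $T$ of finite propagation, i.e. such that for some $L$ the matrix entries $T_{x,y}=(\delta_y,T\delta_x)$ vanish whenever $b(x,y)>L$. It is the same algebra for all $b\in[d_X]$. For a unital $C^*$-algebra $A$, let $S(A)$ be the set of isomorphism classes of associative Hilbert $C^*$-$A$-$A$-bimodules: Banach spaces $M$ that are left and right (unital) $A$-modules with commuting actions and that carry a left and a right $A$-valued inner product making $M$ a left and a right Hilbert $C^*$-module, such that each action is adjointable with respect to the inner product on the other side, the norm of $M$ is equivalent to the norms defined by both inner products, and ${}_A\langle m,n\rangle r=m\langle n,r\rangle_A$ for all $m,n,r\in M$. Multiplication on $S(A)$ is $[M][N]=[M\otimes_A N]$, the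 completed tensor product with the inner products determined by ${}_A\langle m\otimes n,m'\otimes n'\rangle={}_A\langle m\,{}_A\langle n,n'\rangle,m'\rangle$ and $\langle m\otimes n,m'\otimes n'\rangle_A=\langle n,\langle m,m'\rangle_A\, n'\rangle_A$. For a metric $b$ on $X$, let $M(X,b)$ be the set of coarse equivalence classes $[d]$ of metrics $d$ on $X\times\{0,1\}$ that restrict to $b$ on each copy of $X$ and satisfy $\inf_{x,y}d((x,0),(y,1))>0$. Define $i:M(X,b)\to S(C^*_u(X,b))$ by $i([d])=[M_d(X)]$, where $M_d(X)$ is the norm closure in $\mathbb B(\ell^2(X))$ of the operators $T$ such that for some $L$ one has $T_{x,y}=0$ whenever $d((x,0),(y,1))>L$; the actions of $C^*_u(X,b)$ are by composition and the inner products are ${}_{C^*_u}\langle T,S\rangle=TS^*$ and $\langle T,S\rangle_{C^*_u}=T^*S$. Set $$M_c(X,d_X)=\bigcap_{b\in[d_X]} i(M(X,b))\subset S(C^*_u(X,d_X)).$$ **Statement.** (1) With the multiplication of $S(C^*_u(X,d_X))$, $M_c(X,d_X)$ is an inverse semigroup: it is non-empty and closed under multiplication, the multiplication is associative on it, and for each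 $s\in M_c(X,d_X)$ there is exactly one $t\in M_c(X,d_X)$ with $sts=s$ and $tst=t$. (2) It depends only on the coarse equivalence class of the metric: for every metric $b$ on $X$ coarsely equivalent to $d_X$, $M_c(X,d_X)=M_c(X,b)$ as subsets of $S(C^*_u(X,d_X))=S(C^*_u(X,b))$. -/

import Mathlib

open scoped TensorProduct
open MulOpposite Filter Topology

namespace RoeBimodule

universe u

/-- A (left) pre-Hilbert module form with values in a `C*`-algebra. -/
structure IsLeftForm {B E : Type*} [CStarAlgebra B] [AddCommGroup E] [Module B E]
    (f : E → E → B) : Prop where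
  add_left : ∀ x y z, f (x + y) z = f x z + f y z
  smul_left : ∀ (b : B) (x y), f (b • x) y = b * f x y
  star_form : ∀ x y, star (f x y) = f y x
  pos : ∀ x, ∃ b : B, f x x = star b * b

section order
attribute [local instance] CStarAlgebra.spectralOrder CStarAlgebra.spectralOrderedRing

theorem pos_iff {B : Type*} [CStarAlgebra B] (x : B) : (∃ b : B, x = star b * b) ↔ 0 ≤ x :=
  (CStarAlgebra.nonneg_iff_eq_star_mul_self (a := x)).symm

theorem isClosed_pos {B : Type*} [CStarAlgebra B] :
    IsClosed {x : B | ∃ b : B, x = star b * b} := by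
  simp_rw [pos_iff]; exact CStarAlgebra.isClosed_nonneg

theorem pos_op {B : Type*} [CStarAlgebra B] {x : B} (h : ∃ b : B, x = star b * b) :
    ∃ b : Bᵐᵒᵖ, op x = star b * b := by
  obtain ⟨b, rfl⟩ := h
  have h0 : 0 ≤ star b * b := star_mul_self_nonneg b
  obtain ⟨c, hc⟩ := (CStarAlgebra.nonneg_iff_eq_mul_star_self (a := star b * b)).1 h0
  exact ⟨op c, by rw [hc]; rfl⟩

theorem pos_of_spectrum {B : Type*} [CStarAlgebra B] (x : B) (hx : IsSelfAdjoint x)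
    (h : ∀ t ∈ spectrum ℝ x, 0 ≤ t) : ∃ b : B, x = star b * b :=
  (pos_iff x).2 ((StarOrderedRing.nonneg_iff_spectrum_nonneg (R := ℝ) x hx).2 h)

/-- Positivity in a `C*`-subalgebra is positivity in the ambient algebra. -/
theorem pos_of_subalgebra {B : Type*} [CStarAlgebra B] {s : StarSubalgebra ℂ B}
    [hs : IsClosed (s : Set B)] (x : s) (hx : ∃ b : B, (x : B) = star b * b) :
    ∃ c : s, x = star c * c := by
  have h0 : 0 ≤ (x : B) := (pos_iff _).1 hx
  have hsa : IsSelfAdjoint x := Subtype.ext (IsSelfAdjoint.of_nonneg h0 : IsSelfAdjoint (x : B))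
  refine pos_of_spectrum x hsa fun t ht => spectrum_nonneg_of_nonneg h0 ?_
  rw [← spectrum.preimage_algebraMap ℂ, Set.mem_preimage] at ht ⊢
  rwa [StarSubalgebra.spectrum_eq] at ht

namespace IsLeftForm

variable {B E : Type*} [CStarAlgebra B] [AddCommGroup E] [Module B E] {f : E → E → B}

theorem nonneg (h : IsLeftForm f) (x : E) : 0 ≤ f x x := (pos_iff _).1 (h.pos x)

theorem zero_left (h : IsLeftForm f) (y : E) : f 0 y = 0 := by
  have := h.smul_left 0 0 y; simpa using this

theorem add_right (h : IsLeftForm f) (x y z : E) : f x (y + z) = f x y + f x z := by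
  rw [← h.star_form, h.add_left, star_add, h.star_form, h.star_form]

theorem smul_right (h : IsLeftForm f) (b : B) (x y : E) : f x (b • y) = f x y * star b := by
  rw [← h.star_form, h.smul_left, star_mul, h.star_form]

theorem neg_left (h : IsLeftForm f) (x y : E) : f (-x) y = -f x y := by
  have := h.smul_left (-1) x y; simpa using this

theorem neg_right (h : IsLeftForm f) (x y : E) : f x (-y) = -f x y := by
  have := h.smul_right (-1) x y; simpa using this

theorem sub_left (h : IsLeftForm f) (x y z : E) : f (x - y) z = f x z - f y z := by
  rw [sub_eq_add_neg, h.add_left, h.neg_left, sub_eq_add_neg]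

theorem sub_right (h : IsLeftForm f) (x y z : E) : f x (y - z) = f x y - f x z := by
  rw [sub_eq_add_neg, h.add_right, h.neg_right, sub_eq_add_neg]

theorem cauchy_schwarz_aux (h : IsLeftForm f) (x y : E) (r : ℝ) (hr : 0 < r)
    (hx : ‖f x x‖ ≤ r) : ‖f y x‖ ^ 2 ≤ r * ‖f y y‖ := by
  set c := f y x with hc
  have hcs : f x y = star c := (h.star_form y x).symm
  have h0 := h.nonneg (y - (r⁻¹ • c) • x)
  have e : f (y - (r⁻¹ • c) • x) (y - (r⁻¹ • c) • x)
      = f y y - r⁻¹ • (c * star c) - r⁻¹ • (c * star c)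
        + (r⁻¹ * r⁻¹) • (c * f x x * star c) := by
    rw [h.sub_left, h.sub_right, h.sub_right, h.smul_left, h.smul_left, h.smul_right,
      h.smul_right, hcs, ← hc]
    simp only [star_smul, star_trivial, smul_mul_assoc, mul_smul_comm, smul_smul]
    simp only [mul_assoc]
    abel
  have h1 : c * f x x * star c ≤ r • (c * star c) := by
    have hsa : IsSelfAdjoint (f x x) := .of_nonneg (h.nonneg x)
    refine (CStarAlgebra.star_right_conjugate_le_norm_smul (a := c) (b := f x x)
      (hb := hsa)).trans ?_
    exact smul_le_smul_of_nonneg_right hx (mul_star_self_nonneg c)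
  have h2 : r⁻¹ • (c * star c) ≤ f y y := by
    rw [e] at h0
    have h3 : (r⁻¹ * r⁻¹) • (c * f x x * star c) ≤ r⁻¹ • (c * star c) := by
      have := smul_le_smul_of_nonneg_left h1 (show 0 ≤ r⁻¹ * r⁻¹ by positivity)
      rwa [smul_smul, show r⁻¹ * r⁻¹ * r = r⁻¹ by field_simp] at this
    have h4 := h0.trans (add_le_add_right h3 _)
    rw [sub_add_cancel, sub_nonneg] at h4
    exact h4
  have h3 : ‖r⁻¹ • (c * star c)‖ ≤ ‖f y y‖ :=
    CStarAlgebra.norm_le_norm_of_nonneg_of_le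
      (smul_nonneg (by positivity) (mul_star_self_nonneg c)) h2
  rw [norm_smul, CStarRing.norm_self_mul_star, Real.norm_of_nonneg (by positivity)] at h3
  rw [sq]
  calc _ = r * (r⁻¹ * (‖c‖ * ‖c‖)) := by field_simp
    _ ≤ _ := by gcongr

theorem cauchy_schwarz (h : IsLeftForm f) (x y : E) :
    ‖f x y‖ ≤ √‖f x x‖ * √‖f y y‖ := by
  rw [← Real.sqrt_mul (norm_nonneg _)]
  apply Real.le_sqrt_of_sq_le
  have : ∀ ε > 0, ‖f x y‖ ^ 2 ≤ (‖f y y‖ + ε) * ‖f x x‖ := fun ε hε =>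
    h.cauchy_schwarz_aux y x _ (by positivity) (by linarith)
  have ht : Tendsto (fun ε : ℝ => (‖f y y‖ + ε) * ‖f x x‖) (𝓝[>] 0)
      (𝓝 ((‖f y y‖ + 0) * ‖f x x‖)) := by
    apply Tendsto.mono_left _ nhdsWithin_le_nhds
    exact (Continuous.tendsto (by fun_prop) 0)
  rw [add_zero, mul_comm] at ht
  exact ge_of_tendsto ht (eventually_nhdsWithin_of_forall this)

theorem sqrt_add_le (h : IsLeftForm f) (x y : E) :
    √‖f (x + y) (x + y)‖ ≤ √‖f x x‖ + √‖f y y‖ := by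
  apply Real.sqrt_le_iff.2 ⟨by positivity, ?_⟩
  have e : f (x + y) (x + y) = f x x + f x y + (f y x + f y y) := by
    rw [h.add_left, h.add_right, h.add_right]
  rw [e]
  have h1 := h.cauchy_schwarz x y
  have h2 := h.cauchy_schwarz y x
  have h3 := norm_add_le (f x x + f x y) (f y x + f y y)
  have h4 := norm_add_le (f x x) (f x y)
  have h5 := norm_add_le (f y x) (f y y)
  have h6 := Real.sq_sqrt (norm_nonneg (f x x))
  have h7 := Real.sq_sqrt (norm_nonneg (f y y))
  nlinarith

theorem sqrt_smul_le (h : IsLeftForm f) (b : B) (x : E) :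
    √‖f (b • x) (b • x)‖ ≤ ‖b‖ * √‖f x x‖ := by
  rw [h.smul_left, h.smul_right]
  apply Real.sqrt_le_iff.2 ⟨by positivity, ?_⟩
  rw [mul_pow, Real.sq_sqrt (norm_nonneg _)]
  calc _ ≤ ‖b‖ * (‖f x x‖ * ‖star b‖) :=
        (norm_mul_le _ _).trans (by gcongr; exact norm_mul_le _ _)
    _ = _ := by rw [norm_star]; ring

/-- The other algebra acts by bounded adjointable operators. -/
theorem sqrt_adj_le (h : IsLeftForm f) {C : Type*} [CStarAlgebra C] [Module C E] [Module ℂ E]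
    [IsScalarTower ℂ B E] [IsScalarTower ℂ C E]
    (hC : ∀ (c : C) (x y : E), f (c • x) y = f x (star c • y)) (c : C) (x : E) :
    √‖f (c • x) (c • x)‖ ≤ ‖c‖ * √‖f x x‖ := by
  apply Real.sqrt_le_iff.2 ⟨by positivity, ?_⟩
  rw [mul_pow, Real.sq_sqrt (norm_nonneg _)]
  have h0 : 0 ≤ algebraMap ℝ C (‖c‖ ^ 2) - star c * c :=
    sub_nonneg.2 CStarAlgebra.star_mul_le_algebraMap_norm_sq
  obtain ⟨d, hd⟩ := (pos_iff _).2 h0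
  have h1 : f (d • x) (d • x) = (‖c‖ ^ 2) • f x x - f (c • x) (c • x) := by
    have hd' : star d * d = algebraMap ℂ C ((‖c‖ ^ 2 : ℝ) : ℂ) - star c * c := by
      rw [← hd]; rfl
    have hr : f x (((‖c‖ ^ 2 : ℝ) : ℂ) • x) = (‖c‖ ^ 2) • f x x := by
      rw [← algebraMap_smul B, h.smul_right, ← algebraMap_star_comm, ← Algebra.commutes,
        ← Algebra.smul_def, Complex.star_def, Complex.conj_ofReal]
      rfl
    rw [hC, smul_smul, hd', sub_smul, h.sub_right, algebraMap_smul, hr, hC, smul_smul]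
  have h2 : f (c • x) (c • x) ≤ (‖c‖ ^ 2) • f x x := by
    rw [← sub_nonneg, ← h1]; exact h.nonneg _
  refine (CStarAlgebra.norm_le_norm_of_nonneg_of_le (h.nonneg _) h2).trans ?_
  rw [norm_smul, Real.norm_of_nonneg (by positivity)]

theorem approx (h : IsLeftForm f) {ι : Type*} (s : Finset ι) (m : ι → E) (ε : ℝ) (hε : 0 < ε) :
    ∃ b : B, ∀ i ∈ s, √‖f (m i - (∑ k ∈ s, f (b • m k) (b • m k)) • m i)
      (m i - (∑ k ∈ s, f (b • m k) (b • m k)) • m i)‖ ≤ ε := by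
  set c := ∑ k ∈ s, f (m k) (m k) with hc
  have hc0 : 0 ≤ c := Finset.sum_nonneg fun k _ => h.nonneg _
  have hcsa : IsSelfAdjoint c := .of_nonneg hc0
  have hspec : ∀ t ∈ spectrum ℝ c, 0 ≤ t := fun t ht => spectrum_nonneg_of_nonneg hc0 ht
  set δ := ε ^ 2 with hδ
  have hδ0 : 0 < δ := by positivity
  have hcont : ContinuousOn (fun t : ℝ => (√(t + δ))⁻¹) (spectrum ℝ c) := by
    refine ContinuousOn.inv₀ (by fun_prop) fun t ht => ?_
    have := hspec t ht
    positivity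
  set b := cfc (fun t : ℝ => (√(t + δ))⁻¹) c with hb
  have hbsa : star b = b := (cfc_predicate (fun t : ℝ => (√(t + δ))⁻¹) c : IsSelfAdjoint b)
  refine ⟨b, fun i hi => ?_⟩
  have ha : ∑ k ∈ s, f (b • m k) (b • m k) = b * c * b := by
    simp_rw [h.smul_left, h.smul_right, hbsa, ← mul_assoc, ← Finset.sum_mul, ← Finset.mul_sum, ← hc]
  rw [ha]
  set g := (1 : B) - b * c * b with hg
  have hgc : g = cfc (fun t : ℝ => δ * (t + δ)⁻¹) c := by
    have : b * c * b = cfc (fun t : ℝ => (√(t + δ))⁻¹ * t * (√(t + δ))⁻¹) c := by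
      rw [cfc_mul _ _ c (by fun_prop) hcont, cfc_mul _ _ c hcont (by fun_prop), cfc_id' ℝ c]
    rw [hg, this, ← cfc_one ℝ c, ← cfc_sub _ _ c (by fun_prop) (by fun_prop)]
    apply cfc_congr
    intro t ht
    have h0 := hspec t ht
    have h1 : √(t + δ) * √(t + δ) = t + δ := Real.mul_self_sqrt (by positivity)
    have h2 : t + δ ≠ 0 := by positivity
    have h3 : (√(t + δ))⁻¹ * t * (√(t + δ))⁻¹ = t * (t + δ)⁻¹ := by
      rw [← h1, mul_inv]; simp only [h1]; ring
    simp only [Pi.one_apply, h3]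
    field_simp
    ring
  have hgsa : star g = g := by
    rw [hgc]; exact (cfc_predicate (fun t : ℝ => δ * (t + δ)⁻¹) c : IsSelfAdjoint _)
  have hm : m i - (b * c * b) • m i = g • m i := by rw [hg, sub_smul, one_smul]
  rw [hm, h.smul_left, h.smul_right, hgsa]
  apply Real.sqrt_le_iff.2 ⟨hε.le, ?_⟩
  have hle : f (m i) (m i) ≤ c := Finset.single_le_sum (f := fun k => f (m k) (m k))
    (fun k _ => h.nonneg _) hi
  have hconj : g * (f (m i) (m i) * g) ≤ g * (c * g) := by
    have := star_right_conjugate_le_conjugate hle g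
    rwa [hgsa, mul_assoc, mul_assoc] at this
  have h0 : 0 ≤ g * (f (m i) (m i) * g) := by
    have := star_right_conjugate_nonneg (h.nonneg (m i)) g
    rwa [hgsa, mul_assoc] at this
  refine (CStarAlgebra.norm_le_norm_of_nonneg_of_le h0 hconj).trans ?_
  have hcont2 : ContinuousOn (fun t : ℝ => δ * (t + δ)⁻¹) (spectrum ℝ c) := by
    refine ContinuousOn.mul (by fun_prop) (ContinuousOn.inv₀ (by fun_prop) fun t ht => ?_)
    have := hspec t ht
    positivity
  have e : g * (c * g) = cfc (fun t : ℝ => (δ * (t + δ)⁻¹) * (t * (δ * (t + δ)⁻¹))) c := by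
    rw [cfc_mul _ _ c hcont2 (by fun_prop), cfc_mul _ _ c (by fun_prop) hcont2, cfc_id' ℝ c, ← hgc]
  rw [e]
  refine norm_cfc_le hδ0.le fun t ht => ?_
  have h0 := hspec t ht
  rw [Real.norm_of_nonneg (by positivity)]
  have h2 : 0 < t + δ := by positivity
  have : (δ * (t + δ)⁻¹) * (t * (δ * (t + δ)⁻¹)) = δ * ((δ * t) / (t + δ) ^ 2) := by
    field_simp
  rw [this]
  have : (δ * t) / (t + δ) ^ 2 ≤ 1 := by
    rw [div_le_one (by positivity)]; nlinarith
  nlinarith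

end IsLeftForm
end order

/-- Algebraic axioms of a bimodule with two algebra-valued forms, associative up to null vectors. -/
structure IsPre {A E : Type*} [CStarAlgebra A] [AddCommGroup E] [Module A E] [Module Aᵐᵒᵖ E]
    (L R : E → E → A) : Prop where
  left : IsLeftForm L
  right : IsLeftForm (B := Aᵐᵒᵖ) (fun x y => op (R y x))
  right_adj : ∀ (a : A) (x y), R (a • x) y = R x (star a • y)
  left_adj : ∀ (a : A) (x y), L (op a • x) y = L x (op (star a) • y)
  left_assoc : ∀ x y z w, L (L x y • z) w = L (op (R y z) • x) w
  right_assoc : ∀ x y z w, R w (L x y • z) = R w (op (R y z) • x)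

namespace IsPre

variable {A E : Type*} [CStarAlgebra A] [AddCommGroup E] [Module A E] [Module Aᵐᵒᵖ E]
  {L R : E → E → A}

theorem right_pos (h : IsPre L R) (x : E) : ∃ a, R x x = star a * a := by
  obtain ⟨b, hb⟩ := pos_op (h.right.pos x)
  exact ⟨b.unop.unop, congrArg (fun t => t.unop.unop) hb⟩

theorem right_star (h : IsPre L R) (x y : E) : star (R x y) = R y x :=
  op_injective (h.right.star_form y x)

theorem right_smul_right (h : IsPre L R) (a : A) (x y : E) : R x (op a • y) = R x y * a :=
  op_injective (h.right.smul_left (op a) y x)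

theorem right_add_left (h : IsPre L R) (x y z : E) : R (x + y) z = R x z + R y z :=
  op_injective (h.right.add_right z x y)

theorem right_add_right (h : IsPre L R) (x y z : E) : R x (y + z) = R x y + R x z :=
  op_injective (h.right.add_left y z x)

theorem right_smul_left (h : IsPre L R) (a : A) (x y : E) : R (op a • x) y = star a * R x y :=
  op_injective (h.right.smul_right (op a) y x)

variable [Module ℂ E] [IsScalarTower ℂ A E] [IsScalarTower ℂ Aᵐᵒᵖ E]

theorem left_smul_norm (h : IsPre L R) (a : A) (x : E) :
    √‖L (op a • x) (op a • x)‖ ≤ ‖a‖ * √‖L x x‖ :=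
  h.left.sqrt_adj_le (C := Aᵐᵒᵖ) (fun c x y => by simpa using h.left_adj c.unop x y) (op a) x

theorem right_smul_norm (h : IsPre L R) (a : A) (x : E) :
    √‖R (a • x) (a • x)‖ ≤ ‖a‖ * √‖R x x‖ :=
  h.right.sqrt_adj_le (C := A)
    (fun c x y => by simpa using congrArg op (h.right_adj (star c) y x).symm) a x

theorem norm_eq (h : IsPre L R) (x : E) : ‖L x x‖ = ‖R x x‖ := by
  have hL : star (L x x) = L x x := h.left.star_form x x
  have hR : star (R x x) = R x x := h.right_star x x
  apply le_antisymm
  · have h1 : ‖L x x‖ * ‖L x x‖ ≤ ‖R x x‖ * ‖L x x‖ := by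
      rw [← CStarRing.norm_star_mul_self, hL, ← h.left.smul_left, h.left_assoc]
      refine (h.left.cauchy_schwarz _ _).trans ?_
      calc _ ≤ (‖R x x‖ * √‖L x x‖) * √‖L x x‖ := by
            gcongr; exact h.left_smul_norm _ _
        _ = _ := by rw [mul_assoc, Real.mul_self_sqrt (norm_nonneg _)]
    by_contra! hc
    have : 0 < ‖L x x‖ := (norm_nonneg _).trans_lt hc
    nlinarith
  · have h1 : ‖R x x‖ * ‖R x x‖ ≤ ‖L x x‖ * ‖R x x‖ := by
      rw [← CStarRing.norm_star_mul_self, hR, ← h.right_smul_right, ← h.right_assoc]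
      refine (h.right.cauchy_schwarz (L x x • x) x).trans ?_
      calc _ ≤ (‖L x x‖ * √‖R x x‖) * √‖R x x‖ := by
            exact mul_le_mul_of_nonneg_right (h.right_smul_norm _ _) (Real.sqrt_nonneg _)
        _ = _ := by rw [mul_assoc, Real.mul_self_sqrt (norm_nonneg _)]
    by_contra! hc
    have : 0 < ‖R x x‖ := (norm_nonneg _).trans_lt hc
    nlinarith

end IsPre

/-- An associative Hilbert `C*`-`A`-`A`-bimodule over a unital `C*`-algebra `A`: a Banach space which
is a (unital) left and right `A`-module with commuting actions, carrying a left `A`-linear and a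
right `A`-linear positive `A`-valued inner product, such that each action is adjointable for the
other inner product, the norm is equivalent to both norms defined by the inner products (so that
these are definite, and complete), and `⟨m, n⟩ r = m ⟨n, r⟩`. The right action of `a` is that of
`op a`. Positivity of `x` is expressed as `x = b* b`. -/
structure HilbertBimodule (A : Type u) [CStarAlgebra A] where
  carrier : Type u
  [normed : NormedAddCommGroup carrier]
  [normedSpace : NormedSpace ℂ carrier]
  [complete : CompleteSpace carrier]
  [leftModule : Module A carrier]
  [rightModule : Module Aᵐᵒᵖ carrier]
  [left_tower : IsScalarTower ℂ A carrier]
  [right_tower : IsScalarTower ℂ Aᵐᵒᵖ carrier]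
  [smulComm : SMulCommClass A Aᵐᵒᵖ carrier]
  leftInner : carrier → carrier → A
  rightInner : carrier → carrier → A
  leftInner_add : ∀ x y z, leftInner (x + y) z = leftInner x z + leftInner y z
  leftInner_smul : ∀ (a : A) (x y), leftInner (a • x) y = a * leftInner x y
  leftInner_star : ∀ x y, star (leftInner x y) = leftInner y x
  leftInner_pos : ∀ x, ∃ b : A, leftInner x x = star b * b
  rightInner_add : ∀ x y z, rightInner x (y + z) = rightInner x y + rightInner x z
  rightInner_smul : ∀ (a : A) (x y), rightInner x (op a • y) = rightInner x y * a
  rightInner_star : ∀ x y, star (rightInner x y) = rightInner y x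
  rightInner_pos : ∀ x, ∃ b : A, rightInner x x = star b * b
  rightInner_adj : ∀ (a : A) (x y), rightInner (a • x) y = rightInner x (star a • y)
  leftInner_adj : ∀ (a : A) (x y), leftInner (op a • x) y = leftInner x (op (star a) • y)
  leftInner_norm : ∃ c C : ℝ, 0 < c ∧ 0 < C ∧
    ∀ x, c * ‖x‖ ≤ √‖leftInner x x‖ ∧ √‖leftInner x x‖ ≤ C * ‖x‖
  rightInner_norm : ∃ c C : ℝ, 0 < c ∧ 0 < C ∧
    ∀ x, c * ‖x‖ ≤ √‖rightInner x x‖ ∧ √‖rightInner x x‖ ≤ C * ‖x‖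
  assoc : ∀ x y z, leftInner x y • z = op (rightInner y z) • x

namespace HilbertBimodule

attribute [instance] normed normedSpace complete leftModule rightModule left_tower right_tower
  smulComm

variable {A : Type u} [CStarAlgebra A]

theorem isPre (M : HilbertBimodule A) : IsPre M.leftInner M.rightInner where
  left := ⟨M.leftInner_add, M.leftInner_smul, M.leftInner_star, M.leftInner_pos⟩
  right := ⟨fun x y z => congrArg op (M.rightInner_add z x y),
    fun a x y => congrArg op (M.rightInner_smul a.unop y x),
    fun x y => congrArg op (M.rightInner_star y x), fun x => pos_op (M.rightInner_pos x)⟩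
  right_adj := M.rightInner_adj
  left_adj := M.leftInner_adj
  left_assoc x y z w := by rw [M.assoc]
  right_assoc x y z w := by rw [M.assoc]

variable (M N : HilbertBimodule A)

theorem leftInner_csmul (c : ℂ) (x y : M.carrier) :
    M.leftInner (c • x) y = c • M.leftInner x y := by
  rw [← algebraMap_smul A, M.leftInner_smul, ← Algebra.smul_def]

theorem leftInner_csmul_right (c : ℂ) (x y : M.carrier) :
    M.leftInner x (c • y) = star c • M.leftInner x y := by
  rw [← M.leftInner_star, M.leftInner_csmul, star_smul, M.leftInner_star]

theorem rightInner_csmul (c : ℂ) (x y : M.carrier) :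
    M.rightInner x (c • y) = c • M.rightInner x y := by
  rw [← algebraMap_smul Aᵐᵒᵖ, MulOpposite.algebraMap_apply, M.rightInner_smul,
    ← Algebra.commutes, ← Algebra.smul_def]

theorem rightInner_csmul_left (c : ℂ) (x y : M.carrier) :
    M.rightInner (c • x) y = star c • M.rightInner x y := by
  rw [← M.rightInner_star, M.rightInner_csmul, star_smul, M.rightInner_star]

theorem leftInner_add_right (x y z : M.carrier) :
    M.leftInner x (y + z) = M.leftInner x y + M.leftInner x z := M.isPre.left.add_right x y z

theorem rightInner_add_left (x y z : M.carrier) :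
    M.rightInner (x + y) z = M.rightInner x z + M.rightInner y z := M.isPre.right_add_left x y z

theorem smul_csmul (a : A) (c : ℂ) (x : M.carrier) : a • c • x = c • a • x := by
  rw [← algebraMap_smul A c x, smul_smul, ← Algebra.commutes, mul_smul, algebraMap_smul]

theorem op_smul_csmul (a : Aᵐᵒᵖ) (c : ℂ) (x : M.carrier) : a • c • x = c • a • x := by
  rw [← algebraMap_smul Aᵐᵒᵖ c x, smul_smul, ← Algebra.commutes, mul_smul, algebraMap_smul]

instance : SMulCommClass ℂ A M.carrier := ⟨fun c a x => (M.smul_csmul a c x).symm⟩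

instance : SMulCommClass ℂ Aᵐᵒᵖ M.carrier := ⟨fun c a x => (M.op_smul_csmul a c x).symm⟩

/-- The algebraic tensor product `M ⊗ N` over `ℂ`, before dividing by null vectors (in particular by
`m a ⊗ n - m ⊗ a n`) and completing. -/
def PreTensor : Type u := M.carrier ⊗[ℂ] N.carrier

namespace PreTensor

noncomputable instance : AddCommGroup (PreTensor M N) :=
  inferInstanceAs (AddCommGroup (M.carrier ⊗[ℂ] N.carrier))

noncomputable instance : Module ℂ (PreTensor M N) :=
  inferInstanceAs (Module ℂ (M.carrier ⊗[ℂ] N.carrier))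

variable {M N} in
/-- Elementary tensors. -/
def tmul (m : M.carrier) (n : N.carrier) : PreTensor M N := m ⊗ₜ[ℂ] n

variable {M N} in
@[elab_as_elim]
theorem induction {p : PreTensor M N → Prop} (z : PreTensor M N)
    (tmul : ∀ m n, p (tmul m n)) (add : ∀ x y, p x → p y → p (x + y)) : p z := by
  refine TensorProduct.induction_on z ?_ tmul add
  have := tmul 0 0
  rwa [PreTensor.tmul, TensorProduct.zero_tmul] at this

theorem tmul_add (m : M.carrier) (n n' : N.carrier) : tmul m (n + n') = tmul m n + tmul m n' :=
  TensorProduct.tmul_add _ _ _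

theorem add_tmul (m m' : M.carrier) (n : N.carrier) : tmul (m + m') n = tmul m n + tmul m' n :=
  TensorProduct.add_tmul _ _ _

theorem tmul_smul (c : ℂ) (m : M.carrier) (n : N.carrier) : tmul m (c • n) = c • tmul m n :=
  TensorProduct.tmul_smul _ _ _

theorem smul_tmul (c : ℂ) (m : M.carrier) (n : N.carrier) : tmul (c • m) n = c • tmul m n :=
  rfl

/-- `a (m ⊗ n) = (a m) ⊗ n`. -/
noncomputable instance : Module A (PreTensor M N) :=
  inferInstanceAs (Module A (M.carrier ⊗[ℂ] N.carrier))

theorem smul_tmul' (a : A) (m : M.carrier) (n : N.carrier) : a • tmul m n = tmul (a • m) n := rfl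

theorem smul_csmul (a : A) (c : ℂ) (z : PreTensor M N) : a • c • z = c • a • z := by
  induction z using PreTensor.induction with
  | tmul m n => rw [← smul_tmul, smul_tmul', smul_tmul', ← smul_tmul, M.smul_csmul]
  | add x y hx hy => simp only [smul_add, hx, hy]

/-- Right multiplication on the second factor. -/
noncomputable def rightMul (a : Aᵐᵒᵖ) : PreTensor M N →ₗ[ℂ] PreTensor M N :=
  TensorProduct.map LinearMap.id (DistribSMul.toLinearMap ℂ N.carrier a)

theorem rightMul_tmul (a : Aᵐᵒᵖ) (m : M.carrier) (n : N.carrier) :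
    rightMul M N a (tmul m n) = tmul m (a • n) := rfl

/-- `(m ⊗ n) a = m ⊗ (n a)`. -/
noncomputable instance : Module Aᵐᵒᵖ (PreTensor M N) where
  smul a z := rightMul M N a z
  one_smul z := by
    change rightMul M N 1 z = z
    induction z using PreTensor.induction with
    | tmul m n => rw [rightMul_tmul, one_smul]
    | add x y hx hy => rw [map_add, hx, hy]
  mul_smul a b z := by
    change rightMul M N (a * b) z = rightMul M N a (rightMul M N b z)
    induction z using PreTensor.induction with
    | tmul m n => rw [rightMul_tmul, rightMul_tmul, rightMul_tmul, mul_smul]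
    | add x y hx hy => simp only [map_add, hx, hy]
  smul_zero a := map_zero (rightMul M N a)
  smul_add a := map_add (rightMul M N a)
  add_smul a b z := by
    change rightMul M N (a + b) z = rightMul M N a z + rightMul M N b z
    induction z using PreTensor.induction with
    | tmul m n => simp only [rightMul_tmul, add_smul, tmul_add]
    | add x y hx hy => simp only [map_add, hx, hy]; abel
  zero_smul z := by
    change rightMul M N 0 z = 0
    induction z using PreTensor.induction with
    | tmul m n => rw [rightMul_tmul, zero_smul]; exact TensorProduct.tmul_zero _ _
    | add x y hx hy => simp only [map_add, hx, hy, add_zero]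

theorem op_smul_tmul (a : Aᵐᵒᵖ) (m : M.carrier) (n : N.carrier) :
    a • tmul m n = tmul m (a • n) := rfl

instance : SMulCommClass A Aᵐᵒᵖ (PreTensor M N) where
  smul_comm a b z := by
    induction z using PreTensor.induction with
    | tmul m n => rfl
    | add x y hx hy => simp only [smul_add, hx, hy]

instance : IsScalarTower ℂ A (PreTensor M N) where
  smul_assoc c a z := by
    induction z using PreTensor.induction with
    | tmul m n => rw [smul_tmul', smul_assoc, smul_tmul, smul_tmul']
    | add x y hx hy => simp only [smul_add, hx, hy]

instance : IsScalarTower ℂ Aᵐᵒᵖ (PreTensor M N) where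
  smul_assoc c a z := by
    induction z using PreTensor.induction with
    | tmul m n => rw [op_smul_tmul, smul_assoc, tmul_smul, op_smul_tmul]
    | add x y hx hy => simp only [smul_add, hx, hy]

/-- The functional `m' ⊗ n' ↦ ⟨n, ⟨m, m'⟩ n'⟩`. -/
noncomputable def rightFormAux (m : M.carrier) (n : N.carrier) : PreTensor M N →ₗ[ℂ] A :=
  TensorProduct.lift (LinearMap.mk₂ ℂ (fun m' n' => N.rightInner n (M.rightInner m m' • n'))
    (fun x y z => by rw [M.rightInner_add, add_smul, N.rightInner_add])
    (fun c x z => by rw [M.rightInner_csmul, smul_assoc, N.rightInner_csmul])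
    (fun x y z => by rw [smul_add, N.rightInner_add])
    (fun c x z => by rw [N.smul_csmul, N.rightInner_csmul]))

/-- The right inner product on `M ⊗ N`,
`⟨m ⊗ n, m' ⊗ n'⟩ = ⟨n, ⟨m, m'⟩ n'⟩ = ⟨⟨m, m'⟩* n, n'⟩`. -/
noncomputable def rightForm : PreTensor M N →ₗ⋆[ℂ] PreTensor M N →ₗ[ℂ] A :=
  TensorProduct.lift (LinearMap.mk₂'ₛₗ (starRingEnd ℂ) (starRingEnd ℂ) (rightFormAux M N)
    (fun x y z => TensorProduct.ext' fun m n => by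
      change N.rightInner _ _ = N.rightInner _ _ + N.rightInner _ _
      rw [M.rightInner_add_left, add_smul, N.rightInner_add])
    (fun c x z => TensorProduct.ext' fun m n => by
      change N.rightInner _ _ = star c • N.rightInner _ _
      rw [M.rightInner_csmul_left, smul_assoc, N.rightInner_csmul])
    (fun x y z => TensorProduct.ext' fun m n => by
      change N.rightInner _ _ = N.rightInner _ _ + N.rightInner _ _
      rw [N.rightInner_add_left])
    (fun c x z => TensorProduct.ext' fun m n => by
      change N.rightInner _ _ = star c • N.rightInner _ _
      rw [N.rightInner_csmul_left]))

/-- The functional `m' ⊗ n' ↦ ⟨m ⟨n, n'⟩, m'⟩`. -/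
noncomputable def leftFormAux (m : M.carrier) (n : N.carrier) : PreTensor M N →ₗ⋆[ℂ] A :=
  TensorProduct.lift (LinearMap.mk₂'ₛₗ (starRingEnd ℂ) (starRingEnd ℂ)
    (fun m' n' => M.leftInner (op (N.leftInner n n') • m) m')
    (fun x y z => by rw [M.leftInner_add_right])
    (fun c x z => by rw [M.leftInner_csmul_right]; rfl)
    (fun x y z => by rw [N.leftInner_add_right, op_add, add_smul, M.leftInner_add])
    (fun c x z => by
      rw [N.leftInner_csmul_right, op_smul, smul_assoc, M.leftInner_csmul]; rfl))

/-- The left inner product on `M ⊗ N`,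
`⟨m ⊗ n, m' ⊗ n'⟩ = ⟨m ⟨n, n'⟩, m'⟩ = ⟨m, m' ⟨n', n⟩⟩`. -/
noncomputable def leftForm : PreTensor M N →ₗ[ℂ] PreTensor M N →ₗ⋆[ℂ] A :=
  TensorProduct.lift (LinearMap.mk₂ ℂ (leftFormAux M N)
    (fun x y z => TensorProduct.ext' fun m n => by
      change M.leftInner _ _ = M.leftInner _ _ + M.leftInner _ _
      rw [smul_add, M.leftInner_add])
    (fun c x z => TensorProduct.ext' fun m n => by
      change M.leftInner _ _ = c • M.leftInner _ _
      rw [M.op_smul_csmul, M.leftInner_csmul])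
    (fun x y z => TensorProduct.ext' fun m n => by
      change M.leftInner _ _ = M.leftInner _ _ + M.leftInner _ _
      rw [N.leftInner_add, op_add, add_smul, M.leftInner_add])
    (fun c x z => TensorProduct.ext' fun m n => by
      change M.leftInner _ _ = c • M.leftInner _ _
      rw [N.leftInner_csmul, op_smul, smul_assoc, M.leftInner_csmul]))

theorem rightForm_tmul (m m' : M.carrier) (n n' : N.carrier) :
    rightForm M N (tmul m n) (tmul m' n') = N.rightInner n (M.rightInner m m' • n') := rfl

theorem leftForm_tmul (m m' : M.carrier) (n n' : N.carrier) :
    leftForm M N (tmul m n) (tmul m' n') = M.leftInner (op (N.leftInner n n') • m) m' := rfl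

theorem rightForm_star (z w : PreTensor M N) : star (rightForm M N z w) = rightForm M N w z := by
  induction z using PreTensor.induction with
  | add x y hx hy => simp only [map_add, LinearMap.add_apply, star_add, hx, hy]
  | tmul m n =>
    induction w using PreTensor.induction with
    | add x y hx hy => simp only [map_add, LinearMap.add_apply, star_add, hx, hy]
    | tmul m' n' =>
      rw [rightForm_tmul, rightForm_tmul, N.rightInner_star, N.rightInner_adj, M.rightInner_star]

theorem leftForm_star (z w : PreTensor M N) : star (leftForm M N z w) = leftForm M N w z := by
  induction z using PreTensor.induction with
  | add x y hx hy => simp only [map_add, LinearMap.add_apply, star_add, hx, hy]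
  | tmul m n =>
    induction w using PreTensor.induction with
    | add x y hx hy => simp only [map_add, LinearMap.add_apply, star_add, hx, hy]
    | tmul m' n' =>
      rw [leftForm_tmul, leftForm_tmul, M.leftInner_star, M.leftInner_adj, N.leftInner_star]

theorem rightForm_smul (a : A) (z w : PreTensor M N) :
    rightForm M N z (op a • w) = rightForm M N z w * a := by
  induction z using PreTensor.induction with
  | add x y hx hy => simp only [map_add, LinearMap.add_apply, hx, hy, add_mul]
  | tmul m n =>
    induction w using PreTensor.induction with
    | add x y hx hy => simp only [smul_add, map_add, hx, hy, add_mul]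
    | tmul m' n' =>
      rw [op_smul_tmul, rightForm_tmul, rightForm_tmul, SMulCommClass.smul_comm, N.rightInner_smul]

theorem leftForm_smul (a : A) (z w : PreTensor M N) :
    leftForm M N (a • z) w = a * leftForm M N z w := by
  induction z using PreTensor.induction with
  | add x y hx hy => simp only [smul_add, map_add, LinearMap.add_apply, hx, hy, mul_add]
  | tmul m n =>
    induction w using PreTensor.induction with
    | add x y hx hy => simp only [map_add, hx, hy, mul_add]
    | tmul m' n' =>
      rw [smul_tmul', leftForm_tmul, leftForm_tmul, ← SMulCommClass.smul_comm, M.leftInner_smul]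

theorem rightForm_adj (a : A) (z w : PreTensor M N) :
    rightForm M N (a • z) w = rightForm M N z (star a • w) := by
  induction z using PreTensor.induction with
  | add x y hx hy => simp only [smul_add, map_add, LinearMap.add_apply, hx, hy]
  | tmul m n =>
    induction w using PreTensor.induction with
    | add x y hx hy => simp only [smul_add, map_add, hx, hy]
    | tmul m' n' =>
      rw [smul_tmul', smul_tmul', rightForm_tmul, rightForm_tmul, M.rightInner_adj]

theorem leftForm_adj (a : A) (z w : PreTensor M N) :
    leftForm M N (op a • z) w = leftForm M N z (op (star a) • w) := by
  induction z using PreTensor.induction with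
  | add x y hx hy => simp only [smul_add, map_add, LinearMap.add_apply, hx, hy]
  | tmul m n =>
    induction w using PreTensor.induction with
    | add x y hx hy => simp only [smul_add, map_add, hx, hy]
    | tmul m' n' =>
      rw [op_smul_tmul, op_smul_tmul, leftForm_tmul, leftForm_tmul, N.leftInner_adj]

/-- `m ⊗ n ↦ ⟨u, m⟩ n`. -/
noncomputable def leftContract (u : M.carrier) : PreTensor M N →ₗ[ℂ] N.carrier :=
  TensorProduct.lift (LinearMap.mk₂ ℂ (fun m n => M.rightInner u m • n)
    (fun x y z => by rw [M.rightInner_add, add_smul])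
    (fun c x z => by rw [M.rightInner_csmul, smul_assoc])
    (fun x y z => by rw [smul_add])
    (fun c x z => by rw [N.smul_csmul]))

/-- `m ⊗ n ↦ m ⟨n, u⟩`. -/
noncomputable def rightContract (u : N.carrier) : PreTensor M N →ₗ[ℂ] M.carrier :=
  TensorProduct.lift (LinearMap.mk₂ ℂ (fun m n => op (N.leftInner n u) • m)
    (fun x y z => by rw [smul_add])
    (fun c x z => by rw [M.op_smul_csmul])
    (fun x y z => by rw [N.leftInner_add, op_add, add_smul])
    (fun c x z => by rw [N.leftInner_csmul, op_smul, smul_assoc]))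

theorem leftContract_tmul (u m : M.carrier) (n : N.carrier) :
    leftContract M N u (tmul m n) = M.rightInner u m • n := rfl

theorem rightContract_tmul (m : M.carrier) (u n : N.carrier) :
    rightContract M N u (tmul m n) = op (N.leftInner n u) • m := rfl

theorem rightForm_contract (u : M.carrier) (z w : PreTensor M N) :
    rightForm M N (M.leftInner u u • z) w
      = N.rightInner (leftContract M N u z) (leftContract M N u w) := by
  induction z using PreTensor.induction with
  | add x y hx hy =>
    simp only [smul_add, map_add, LinearMap.add_apply, hx, hy, N.rightInner_add_left]
  | tmul m n =>
    induction w using PreTensor.induction with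
    | add x y hx hy => simp only [map_add, hx, hy, N.rightInner_add]
    | tmul m' n' =>
      rw [smul_tmul', rightForm_tmul, M.assoc, M.isPre.right_smul_left, mul_smul,
        ← N.rightInner_adj]
      rfl

theorem leftForm_contract (u : N.carrier) (z w : PreTensor M N) :
    leftForm M N (op (N.rightInner u u) • z) w
      = M.leftInner (rightContract M N u z) (rightContract M N u w) := by
  induction z using PreTensor.induction with
  | add x y hx hy =>
    simp only [smul_add, map_add, LinearMap.add_apply, hx, hy, M.leftInner_add]
  | tmul m n =>
    induction w using PreTensor.induction with
    | add x y hx hy => simp only [map_add, hx, hy, M.leftInner_add_right]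
    | tmul m' n' =>
      rw [op_smul_tmul, leftForm_tmul, ← N.assoc, N.leftInner_smul, op_mul, mul_smul,
        ← N.leftInner_star n' u, M.leftInner_adj, star_star]
      rfl

theorem rightForm_bound (n : N.carrier) (w : PreTensor M N) :
    ∃ K : ℝ, 0 ≤ K ∧ ∀ m, ‖rightForm M N (tmul m n) w‖ ≤ K * √‖M.leftInner m m‖ := by
  induction w using PreTensor.induction with
  | add x y hx hy =>
    obtain ⟨K, hK, h⟩ := hx
    obtain ⟨K', hK', h'⟩ := hy
    refine ⟨K + K', by positivity, fun m => ?_⟩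
    rw [map_add, add_mul]
    exact (norm_add_le _ _).trans (add_le_add (h m) (h' m))
  | tmul m' n' =>
    refine ⟨√‖N.rightInner n n‖ * (√‖M.rightInner m' m'‖ * √‖N.rightInner n' n'‖),
      by positivity, fun m => ?_⟩
    rw [rightForm_tmul]
    have h1 := N.isPre.right.cauchy_schwarz (M.rightInner m m' • n') n
    have h2 := N.isPre.right_smul_norm (M.rightInner m m') n'
    have h3 := M.isPre.right.cauchy_schwarz m' m
    simp only [norm_op] at h1 h3
    rw [M.isPre.norm_eq]
    calc _ ≤ _ := h1
      _ ≤ (‖M.rightInner m m'‖ * √‖N.rightInner n' n'‖) * √‖N.rightInner n n‖ := by gcongr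
      _ ≤ ((√‖M.rightInner m' m'‖ * √‖M.rightInner m m‖) * √‖N.rightInner n' n'‖)
            * √‖N.rightInner n n‖ := by gcongr
      _ = _ := by ring

theorem leftForm_bound (m : M.carrier) (w : PreTensor M N) :
    ∃ K : ℝ, 0 ≤ K ∧ ∀ n, ‖leftForm M N (tmul m n) w‖ ≤ K * √‖N.rightInner n n‖ := by
  induction w using PreTensor.induction with
  | add x y hx hy =>
    obtain ⟨K, hK, h⟩ := hx
    obtain ⟨K', hK', h'⟩ := hy
    refine ⟨K + K', by positivity, fun m => ?_⟩
    rw [map_add, add_mul]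
    exact (norm_add_le _ _).trans (add_le_add (h m) (h' m))
  | tmul m' n' =>
    refine ⟨√‖M.leftInner m m‖ * (√‖M.leftInner m' m'‖ * √‖N.leftInner n' n'‖),
      by positivity, fun n => ?_⟩
    rw [leftForm_tmul]
    have h1 := M.isPre.left.cauchy_schwarz (op (N.leftInner n n') • m) m'
    have h2 := M.isPre.left_smul_norm (N.leftInner n n') m
    have h3 := N.isPre.left.cauchy_schwarz n n'
    rw [← N.isPre.norm_eq]
    calc _ ≤ _ := h1
      _ ≤ (‖N.leftInner n n'‖ * √‖M.leftInner m m‖) * √‖M.leftInner m' m'‖ := by gcongr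
      _ ≤ ((√‖N.leftInner n n‖ * √‖N.leftInner n' n'‖) * √‖M.leftInner m m‖)
            * √‖M.leftInner m' m'‖ := by gcongr
      _ = _ := by ring

theorem exists_sum (z : PreTensor M N) :
    ∃ s : Finset (M.carrier × N.carrier), z = ∑ i ∈ s, tmul i.1 i.2 :=
  TensorProduct.exists_finset z

section order
attribute [local instance] CStarAlgebra.spectralOrder CStarAlgebra.spectralOrderedRing

theorem rightForm_pos (z : PreTensor M N) : ∃ a, rightForm M N z z = star a * a := by
  obtain ⟨s, hs⟩ := exists_sum M N z
  choose K hK0 hK using fun i : M.carrier × N.carrier => rightForm_bound M N i.2 z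
  refine Metric.mem_of_closed' isClosed_pos |>.2 fun ε hε => ?_
  have hS : 0 ≤ ∑ i ∈ s, K i := Finset.sum_nonneg fun i _ => hK0 i
  obtain ⟨b, hb⟩ := M.isPre.left.approx s Prod.fst (ε / (∑ i ∈ s, K i + 1)) (by positivity)
  set a := ∑ k ∈ s, M.leftInner (b • k.1) (b • k.1) with ha
  refine ⟨rightForm M N (a • z) z, ?_, ?_⟩
  · refine (pos_iff _).2 ?_
    rw [ha, Finset.sum_smul, map_sum, LinearMap.sum_apply]
    refine Finset.sum_nonneg fun k _ => ?_
    rw [rightForm_contract]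
    exact (pos_iff _).1 (N.rightInner_pos _)
  · have e : z - a • z = ∑ i ∈ s, tmul (i.1 - a • i.1) i.2 := by
      conv_lhs => rw [hs]
      rw [Finset.smul_sum, ← Finset.sum_sub_distrib]
      refine Finset.sum_congr rfl fun i _ => ?_
      rw [smul_tmul', sub_eq_iff_eq_add, ← add_tmul, sub_add_cancel]
    rw [dist_eq_norm, ← LinearMap.sub_apply, ← map_sub, e, map_sum, LinearMap.sum_apply]
    refine (norm_sum_le _ _).trans_lt ?_
    calc _ ≤ ∑ i ∈ s, K i * (ε / (∑ i ∈ s, K i + 1)) := Finset.sum_le_sum fun i hi =>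
          (hK i _).trans (mul_le_mul_of_nonneg_left (hb i hi) (hK0 i))
      _ = (∑ i ∈ s, K i) * (ε / (∑ i ∈ s, K i + 1)) := by rw [Finset.sum_mul]
      _ < ε := by
        rw [← mul_div_assoc, div_lt_iff₀ (by positivity)]
        nlinarith

theorem leftForm_pos (z : PreTensor M N) : ∃ a, leftForm M N z z = star a * a := by
  obtain ⟨s, hs⟩ := exists_sum M N z
  choose K hK0 hK using fun i : M.carrier × N.carrier => leftForm_bound M N i.1 z
  refine Metric.mem_of_closed' isClosed_pos |>.2 fun ε hε => ?_
  have hS : 0 ≤ ∑ i ∈ s, K i := Finset.sum_nonneg fun i _ => hK0 i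
  obtain ⟨b, hb⟩ := N.isPre.right.approx s Prod.snd (ε / (∑ i ∈ s, K i + 1)) (by positivity)
  set a := ∑ k ∈ s, op (N.rightInner (b • k.2) (b • k.2)) with ha
  refine ⟨leftForm M N (a • z) z, ?_, ?_⟩
  · refine (pos_iff _).2 ?_
    rw [ha, Finset.sum_smul, map_sum, LinearMap.sum_apply]
    refine Finset.sum_nonneg fun k _ => ?_
    rw [leftForm_contract]
    exact (pos_iff _).1 (M.leftInner_pos _)
  · have e : z - a • z = ∑ i ∈ s, tmul i.1 (i.2 - a • i.2) := by
      conv_lhs => rw [hs]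
      rw [Finset.smul_sum, ← Finset.sum_sub_distrib]
      refine Finset.sum_congr rfl fun i _ => ?_
      rw [op_smul_tmul, sub_eq_iff_eq_add, ← tmul_add, sub_add_cancel]
    rw [dist_eq_norm, ← LinearMap.sub_apply, ← map_sub, e, map_sum, LinearMap.sum_apply]
    refine (norm_sum_le _ _).trans_lt ?_
    calc _ ≤ ∑ i ∈ s, K i * (ε / (∑ i ∈ s, K i + 1)) := Finset.sum_le_sum fun i hi =>
          (hK i _).trans (mul_le_mul_of_nonneg_left (hb i hi) (hK0 i))
      _ = (∑ i ∈ s, K i) * (ε / (∑ i ∈ s, K i + 1)) := by rw [Finset.sum_mul]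
      _ < ε := by
        rw [← mul_div_assoc, div_lt_iff₀ (by positivity)]
        nlinarith

end order

theorem rightForm_assoc (x y z w : PreTensor M N) :
    rightForm M N w (leftForm M N x y • z) = rightForm M N w (op (rightForm M N y z) • x) := by
  induction x using PreTensor.induction with
  | add x x' hx hx' => simp only [map_add, LinearMap.add_apply, add_smul, smul_add, hx, hx']
  | tmul m₁ n₁ =>
  induction y using PreTensor.induction with
  | add x x' hx hx' => simp only [map_add, LinearMap.add_apply, op_add, add_smul, hx, hx']
  | tmul m₂ n₂ =>
  induction z using PreTensor.induction with
  | add x x' hx hx' => simp only [map_add, op_add, add_smul, smul_add, hx, hx']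
  | tmul m₃ n₃ =>
  induction w using PreTensor.induction with
  | add x x' hx hx' => simp only [map_add, LinearMap.add_apply, hx, hx']
  | tmul m₄ n₄ =>
    rw [smul_tmul', op_smul_tmul, leftForm_tmul, M.assoc, rightForm_tmul, rightForm_tmul,
      rightForm_tmul, M.isPre.right_smul_right, M.isPre.right_smul_right, mul_smul, mul_smul,
      ← N.assoc]

theorem leftForm_assoc (x y z w : PreTensor M N) :
    leftForm M N (leftForm M N x y • z) w = leftForm M N (op (rightForm M N y z) • x) w := by
  induction x using PreTensor.induction with
  | add x x' hx hx' => simp only [map_add, LinearMap.add_apply, add_smul, smul_add, hx, hx']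
  | tmul m₁ n₁ =>
  induction y using PreTensor.induction with
  | add x x' hx hx' => simp only [map_add, LinearMap.add_apply, op_add, add_smul, hx, hx']
  | tmul m₂ n₂ =>
  induction z using PreTensor.induction with
  | add x x' hx hx' => simp only [map_add, op_add, add_smul, smul_add, hx, hx', LinearMap.add_apply]
  | tmul m₃ n₃ =>
  induction w using PreTensor.induction with
  | add x x' hx hx' => simp only [map_add, hx, hx']
  | tmul m₄ n₄ =>
    rw [smul_tmul', op_smul_tmul, rightForm_tmul, leftForm_tmul, leftForm_tmul, leftForm_tmul,
      M.assoc, ← N.assoc, N.leftInner_smul, N.leftInner_smul, op_mul, op_mul, mul_smul, mul_smul]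

theorem isPre : IsPre (fun x y => leftForm M N x y) (fun x y => rightForm M N x y) where
  left := ⟨fun x y z => by rw [map_add, LinearMap.add_apply], leftForm_smul M N,
    leftForm_star M N, leftForm_pos M N⟩
  right := ⟨fun x y z => by rw [map_add, op_add],
    fun a x y => congrArg op (rightForm_smul M N a.unop y x),
    fun x y => congrArg op (rightForm_star M N y x), fun x => pos_op (rightForm_pos M N x)⟩
  right_adj := rightForm_adj M N
  left_adj := leftForm_adj M N
  left_assoc := leftForm_assoc M N
  right_assoc := rightForm_assoc M N

/-- The seminorm `‖⟨z, z⟩‖^(1/2)`; the two inner products define the same one. -/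
noncomputable def seminorm : AddGroupSeminorm (PreTensor M N) where
  toFun z := √‖leftForm M N z z‖
  map_zero' := by simp
  add_le' := (isPre M N).left.sqrt_add_le
  neg' z := by rw [map_neg, map_neg, LinearMap.neg_apply, neg_neg]

noncomputable instance : SeminormedAddCommGroup (PreTensor M N) :=
  { (seminorm M N).toSeminormedAddCommGroup with
    toAddCommGroup := inferInstance }

theorem norm_def (z : PreTensor M N) : ‖z‖ = √‖leftForm M N z z‖ := rfl

theorem norm_def' (z : PreTensor M N) : ‖z‖ = √‖rightForm M N z z‖ := by
  rw [norm_def]; exact congrArg _ ((isPre M N).norm_eq z)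

theorem norm_smul_le' (a : A) (z : PreTensor M N) : ‖a • z‖ ≤ ‖a‖ * ‖z‖ :=
  (isPre M N).left.sqrt_smul_le a z

theorem norm_op_smul_le (a : Aᵐᵒᵖ) (z : PreTensor M N) : ‖a • z‖ ≤ ‖a‖ * ‖z‖ :=
  (isPre M N).left_smul_norm a.unop z

theorem norm_leftForm_le (z w : PreTensor M N) : ‖leftForm M N z w‖ ≤ ‖z‖ * ‖w‖ :=
  (isPre M N).left.cauchy_schwarz z w

theorem norm_rightForm_le (z w : PreTensor M N) : ‖rightForm M N z w‖ ≤ ‖z‖ * ‖w‖ := by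
  rw [norm_def', norm_def', mul_comm]
  exact (isPre M N).right.cauchy_schwarz w z

noncomputable instance : NormedSpace ℂ (PreTensor M N) where
  norm_smul_le c z := by
    rw [norm_def, norm_def, (leftForm M N).map_smul, LinearMap.smul_apply, LinearMap.map_smulₛₗ, norm_smul,
      norm_smul, RCLike.norm_conj, ← mul_assoc, Real.sqrt_mul (by positivity),
      Real.sqrt_mul_self (norm_nonneg _)]

instance : UniformContinuousConstSMul A (PreTensor M N) where
  uniformContinuous_const_smul a :=
    (AddMonoidHomClass.lipschitz_of_bound (DistribSMul.toAddMonoidHom (PreTensor M N) a) ‖a‖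
      (norm_smul_le' M N a)).uniformContinuous

instance : UniformContinuousConstSMul Aᵐᵒᵖ (PreTensor M N) where
  uniformContinuous_const_smul a :=
    (AddMonoidHomClass.lipschitz_of_bound (DistribSMul.toAddMonoidHom (PreTensor M N) a) ‖a‖
      (norm_op_smul_le M N a)).uniformContinuous

end PreTensor

open UniformSpace

/-- Extension of a continuous biadditive map to the completion. -/
noncomputable def extForm {E B : Type*} [SeminormedAddCommGroup E] [NormedAddCommGroup B]
    (F : E →+ E →+ B) : Completion E → Completion E → B :=
  Function.curry <| ((Completion.isDenseInducing_toCompl E).prodMap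
    (Completion.isDenseInducing_toCompl E)).extend fun p : E × E => F p.1 p.2

theorem extForm_coe {E B : Type*} [SeminormedAddCommGroup E] [NormedAddCommGroup B]
    {F : E →+ E →+ B} (hF : Continuous fun p : E × E => F p.1 p.2) (x y : E) :
    extForm F x y = F x y :=
  ((Completion.isDenseInducing_toCompl E).prodMap
    (Completion.isDenseInducing_toCompl E)).extend_eq hF (x, y)

theorem continuous_extForm {E B : Type*} [SeminormedAddCommGroup E] [NormedAddCommGroup B]
    [CompleteSpace B] {F : E →+ E →+ B} (hF : Continuous fun p : E × E => F p.1 p.2) :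
    Continuous fun p : Completion E × Completion E => extForm F p.1 p.2 :=
  (Completion.isDenseInducing_toCompl E).extend_Z_bilin (Completion.isDenseInducing_toCompl E) hF

theorem continuous_biadd {E B : Type*} [SeminormedAddCommGroup E] [NormedAddCommGroup B]
    (F : E →+ E →+ B) (hF : ∀ x y, ‖F x y‖ ≤ ‖x‖ * ‖y‖) :
    Continuous fun p : E × E => F p.1 p.2 := by
  rw [continuous_iff_continuousAt]
  rintro ⟨a, b⟩
  rw [ContinuousAt, tendsto_iff_norm_sub_tendsto_zero]
  have hb : ∀ p : E × E, ‖F p.1 p.2 - F a b‖ ≤ ‖p.1 - a‖ * ‖p.2‖ + ‖a‖ * ‖p.2 - b‖ := fun p => by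
    have : F p.1 p.2 - F a b = F (p.1 - a) p.2 + F a (p.2 - b) := by
      rw [map_sub, map_sub, AddMonoidHom.sub_apply]; abel
    rw [this]
    exact (norm_add_le _ _).trans (add_le_add (hF _ _) (hF _ _))
  refine squeeze_zero (fun _ => norm_nonneg _) hb ?_
  have : Continuous fun p : E × E => ‖p.1 - a‖ * ‖p.2‖ + ‖a‖ * ‖p.2 - b‖ := by fun_prop
  simpa using this.tendsto (a, b)

namespace PreTensor

/-- The forms as biadditive maps. -/
noncomputable def leftHom : PreTensor M N →+ PreTensor M N →+ A where
  toFun x := (leftForm M N x).toAddMonoidHom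
  map_zero' := by ext; simp
  map_add' x y := by ext; simp

noncomputable def rightHom : PreTensor M N →+ PreTensor M N →+ A where
  toFun x := (rightForm M N x).toAddMonoidHom
  map_zero' := by ext; simp
  map_add' x y := by ext; simp

theorem continuous_leftHom : Continuous fun p : PreTensor M N × PreTensor M N =>
    leftHom M N p.1 p.2 := continuous_biadd _ (norm_leftForm_le M N)

theorem continuous_rightHom : Continuous fun p : PreTensor M N × PreTensor M N =>
    rightHom M N p.1 p.2 := continuous_biadd _ (norm_rightForm_le M N)

/-- The left inner product on the completion. -/
noncomputable def leftExt : Completion (PreTensor M N) → Completion (PreTensor M N) → A :=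
  extForm (leftHom M N)

/-- The right inner product on the completion. -/
noncomputable def rightExt : Completion (PreTensor M N) → Completion (PreTensor M N) → A :=
  extForm (rightHom M N)

theorem leftExt_coe (x y : PreTensor M N) : leftExt M N x y = leftForm M N x y :=
  extForm_coe (continuous_leftHom M N) x y

theorem rightExt_coe (x y : PreTensor M N) : rightExt M N x y = rightForm M N x y :=
  extForm_coe (continuous_rightHom M N) x y

theorem continuous_leftExt : Continuous fun p :
    Completion (PreTensor M N) × Completion (PreTensor M N) => leftExt M N p.1 p.2 :=
  continuous_extForm (continuous_leftHom M N)

theorem continuous_rightExt : Continuous fun p :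
    Completion (PreTensor M N) × Completion (PreTensor M N) => rightExt M N p.1 p.2 :=
  continuous_extForm (continuous_rightHom M N)

@[fun_prop]
theorem continuous_leftExt₂ {α : Type*} [TopologicalSpace α]
    {f g : α → Completion (PreTensor M N)} (hf : Continuous f) (hg : Continuous g) :
    Continuous fun x => leftExt M N (f x) (g x) :=
  (continuous_leftExt M N).comp (hf.prodMk hg)

@[fun_prop]
theorem continuous_rightExt₂ {α : Type*} [TopologicalSpace α]
    {f g : α → Completion (PreTensor M N)} (hf : Continuous f) (hg : Continuous g) :
    Continuous fun x => rightExt M N (f x) (g x) :=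
  (continuous_rightExt M N).comp (hf.prodMk hg)

theorem norm_completion_left (x : Completion (PreTensor M N)) : ‖x‖ = √‖leftExt M N x x‖ := by
  induction x using Completion.induction_on with
  | hp => exact isClosed_eq (by fun_prop) (by fun_prop)
  | ih z => rw [leftExt_coe, Completion.norm_coe, norm_def]

theorem norm_completion_right (x : Completion (PreTensor M N)) : ‖x‖ = √‖rightExt M N x x‖ := by
  induction x using Completion.induction_on with
  | hp => exact isClosed_eq (by fun_prop) (by fun_prop)
  | ih z => rw [rightExt_coe, Completion.norm_coe, norm_def']

instance : ContinuousConstSMul A (Completion (PreTensor M N)) :=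
  UniformContinuousConstSMul.instContinuousConstSMul _ _

instance : ContinuousConstSMul Aᵐᵒᵖ (Completion (PreTensor M N)) :=
  UniformContinuousConstSMul.instContinuousConstSMul _ _

theorem norm_smul_ext (a : A) (x : Completion (PreTensor M N)) : ‖a • x‖ ≤ ‖a‖ * ‖x‖ := by
  induction x using Completion.induction_on with
  | hp => exact isClosed_le (continuous_const_smul a).norm (continuous_const.mul continuous_norm)
  | ih z =>
    rw [← Completion.coe_smul, Completion.norm_coe, Completion.norm_coe]
    exact norm_smul_le' M N a z

theorem norm_op_smul_ext (a : Aᵐᵒᵖ) (x : Completion (PreTensor M N)) : ‖a • x‖ ≤ ‖a‖ * ‖x‖ := by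
  induction x using Completion.induction_on with
  | hp => exact isClosed_le (continuous_const_smul a).norm (continuous_const.mul continuous_norm)
  | ih z =>
    rw [← Completion.coe_smul, Completion.norm_coe, Completion.norm_coe]
    exact norm_op_smul_le M N a z

instance : IsBoundedSMul A (Completion (PreTensor M N)) := .of_norm_smul_le (norm_smul_ext M N)

instance : IsBoundedSMul Aᵐᵒᵖ (Completion (PreTensor M N)) :=
  .of_norm_smul_le (norm_op_smul_ext M N)

theorem assoc_ext (x y z : Completion (PreTensor M N)) :
    leftExt M N x y • z = op (rightExt M N y z) • x := by
  induction x, y, z using Completion.induction_on₃ with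
  | hp => exact isClosed_eq (by fun_prop) (by fun_prop)
  | ih x y z =>
    rw [leftExt_coe, rightExt_coe, ← Completion.coe_smul, ← Completion.coe_smul, ← sub_eq_zero,
      ← Completion.coe_sub, ← norm_eq_zero, Completion.norm_coe, norm_def,
      (isPre M N).left.sub_left, leftForm_assoc, sub_self, norm_zero, Real.sqrt_zero]

end PreTensor

open PreTensor in
/-- The (interior) tensor product `M ⊗_A N`: the completion of the algebraic tensor product with
respect to the seminorm defined by the inner products
`⟨m ⊗ n, m' ⊗ n'⟩ = ⟨m ⟨n, n'⟩, m'⟩` (left) and `⟨m ⊗ n, m' ⊗ n'⟩ = ⟨n, ⟨m, m'⟩ n'⟩` (right).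
Null vectors, in particular `m a ⊗ n - m ⊗ a n`, become zero. -/
noncomputable def tensor : HilbertBimodule A where
  carrier := Completion (PreTensor M N)
  leftInner := leftExt M N
  rightInner := rightExt M N
  leftInner_add x y z := by
    induction x, y, z using Completion.induction_on₃ with
    | hp => exact isClosed_eq (by fun_prop) (by fun_prop)
    | ih x y z => simp only [← Completion.coe_add, leftExt_coe, map_add, LinearMap.add_apply]
  rightInner_add x y z := by
    induction x, y, z using Completion.induction_on₃ with
    | hp => exact isClosed_eq (by fun_prop) (by fun_prop)
    | ih x y z => simp only [← Completion.coe_add, rightExt_coe, map_add]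
  leftInner_smul a x y := by
    induction x, y using Completion.induction_on₂ with
    | hp =>
      exact isClosed_eq
        (continuous_leftExt₂ M N ((continuous_const_smul a).comp continuous_fst) continuous_snd)
        (continuous_const.mul (continuous_leftExt M N))
    | ih x y => rw [← Completion.coe_smul, leftExt_coe, leftExt_coe, leftForm_smul]
  rightInner_smul a x y := by
    induction x, y using Completion.induction_on₂ with
    | hp =>
      exact isClosed_eq
        (continuous_rightExt₂ M N continuous_fst
          ((continuous_const_smul (op a)).comp continuous_snd))
        ((continuous_rightExt M N).mul continuous_const)
    | ih x y => rw [← Completion.coe_smul, rightExt_coe, rightExt_coe, rightForm_smul]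
  leftInner_star x y := by
    induction x, y using Completion.induction_on₂ with
    | hp =>
      exact isClosed_eq
        (continuous_leftExt M N).star
        (continuous_leftExt₂ M N continuous_snd continuous_fst)
    | ih x y => rw [leftExt_coe, leftExt_coe, leftForm_star]
  rightInner_star x y := by
    induction x, y using Completion.induction_on₂ with
    | hp =>
      exact isClosed_eq
        (continuous_rightExt M N).star
        (continuous_rightExt₂ M N continuous_snd continuous_fst)
    | ih x y => rw [rightExt_coe, rightExt_coe, rightForm_star]
  leftInner_pos x := by
    induction x using Completion.induction_on with
    | hp => exact isClosed_pos.preimage (continuous_leftExt₂ M N continuous_id continuous_id)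
    | ih x => rw [leftExt_coe]; exact leftForm_pos M N x
  rightInner_pos x := by
    induction x using Completion.induction_on with
    | hp => exact isClosed_pos.preimage (continuous_rightExt₂ M N continuous_id continuous_id)
    | ih x => rw [rightExt_coe]; exact rightForm_pos M N x
  leftInner_adj a x y := by
    induction x, y using Completion.induction_on₂ with
    | hp =>
      exact isClosed_eq
        (continuous_leftExt₂ M N ((continuous_const_smul (op a)).comp continuous_fst) continuous_snd)
        (continuous_leftExt₂ M N continuous_fst
          ((continuous_const_smul (op (star a))).comp continuous_snd))
    | ih x y =>
      rw [← Completion.coe_smul, ← Completion.coe_smul, leftExt_coe, leftExt_coe, leftForm_adj]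
  rightInner_adj a x y := by
    induction x, y using Completion.induction_on₂ with
    | hp =>
      exact isClosed_eq
        (continuous_rightExt₂ M N ((continuous_const_smul a).comp continuous_fst) continuous_snd)
        (continuous_rightExt₂ M N continuous_fst
          ((continuous_const_smul (star a)).comp continuous_snd))
    | ih x y =>
      rw [← Completion.coe_smul, ← Completion.coe_smul, rightExt_coe, rightExt_coe, rightForm_adj]
  leftInner_norm := ⟨1, 1, one_pos, one_pos, fun x => by
    rw [one_mul, ← norm_completion_left]; exact ⟨le_rfl, le_rfl⟩⟩
  rightInner_norm := ⟨1, 1, one_pos, one_pos, fun x => by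
    rw [one_mul, ← norm_completion_right]; exact ⟨le_rfl, le_rfl⟩⟩
  assoc := assoc_ext M N

/-- An isomorphism of associative Hilbert `C*`-bimodules: a bijective bimodule map preserving both
inner products. -/
structure Iso (M N : HilbertBimodule A) where
  toEquiv : M.carrier ≃ₗ[A] N.carrier
  map_op_smul : ∀ (a : A) (x : M.carrier), toEquiv (op a • x) = op a • toEquiv x
  map_leftInner : ∀ x y, N.leftInner (toEquiv x) (toEquiv y) = M.leftInner x y
  map_rightInner : ∀ x y, N.rightInner (toEquiv x) (toEquiv y) = M.rightInner x y

namespace Iso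

variable {M N} {M' N' P : HilbertBimodule A}

def refl (M : HilbertBimodule A) : Iso M M :=
  ⟨LinearEquiv.refl A M.carrier, fun _ _ => rfl, fun _ _ => rfl, fun _ _ => rfl⟩

def symm (f : Iso M N) : Iso N M where
  toEquiv := f.toEquiv.symm
  map_op_smul a x := by
    apply f.toEquiv.injective
    rw [f.map_op_smul, LinearEquiv.apply_symm_apply, LinearEquiv.apply_symm_apply]
  map_leftInner x y := by rw [← f.map_leftInner]; simp
  map_rightInner x y := by rw [← f.map_rightInner]; simp

def trans (f : Iso M N) (g : Iso N P) : Iso M P where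
  toEquiv := f.toEquiv.trans g.toEquiv
  map_op_smul a x := by simp [f.map_op_smul, g.map_op_smul]
  map_leftInner x y := by simp [f.map_leftInner, g.map_leftInner]
  map_rightInner x y := by simp [f.map_rightInner, g.map_rightInner]

/-- `f ⊗ g` on the algebraic tensor products. -/
noncomputable def preMap (f : Iso M M') (g : Iso N N') : PreTensor M N →ₗ[ℂ] PreTensor M' N' :=
  TensorProduct.map (f.toEquiv.toLinearMap.restrictScalars ℂ)
    (g.toEquiv.toLinearMap.restrictScalars ℂ)

variable (f : Iso M M') (g : Iso N N')

theorem preMap_tmul (m : M.carrier) (n : N.carrier) :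
    preMap f g (PreTensor.tmul m n) = PreTensor.tmul (f.toEquiv m) (g.toEquiv n) := rfl

theorem preMap_leftForm (z w : PreTensor M N) :
    PreTensor.leftForm M' N' (preMap f g z) (preMap f g w) = PreTensor.leftForm M N z w := by
  induction z using PreTensor.induction with
  | add x y hx hy => simp only [map_add, LinearMap.add_apply, hx, hy]
  | tmul m n =>
    induction w using PreTensor.induction with
    | add x y hx hy => simp only [map_add, hx, hy]
    | tmul m' n' =>
      rw [preMap_tmul, preMap_tmul, PreTensor.leftForm_tmul, PreTensor.leftForm_tmul,
        g.map_leftInner, ← f.map_op_smul, f.map_leftInner]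

theorem preMap_rightForm (z w : PreTensor M N) :
    PreTensor.rightForm M' N' (preMap f g z) (preMap f g w) = PreTensor.rightForm M N z w := by
  induction z using PreTensor.induction with
  | add x y hx hy => simp only [map_add, LinearMap.add_apply, hx, hy]
  | tmul m n =>
    induction w using PreTensor.induction with
    | add x y hx hy => simp only [map_add, hx, hy]
    | tmul m' n' =>
      rw [preMap_tmul, preMap_tmul, PreTensor.rightForm_tmul, PreTensor.rightForm_tmul,
        f.map_rightInner, ← map_smul, g.map_rightInner]

theorem preMap_smul (a : A) (z : PreTensor M N) : preMap f g (a • z) = a • preMap f g z := by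
  induction z using PreTensor.induction with
  | add x y hx hy => simp only [smul_add, map_add, hx, hy]
  | tmul m n =>
    rw [PreTensor.smul_tmul', preMap_tmul, preMap_tmul, PreTensor.smul_tmul', map_smul]

theorem preMap_op_smul (a : A) (z : PreTensor M N) :
    preMap f g (op a • z) = op a • preMap f g z := by
  induction z using PreTensor.induction with
  | add x y hx hy => simp only [smul_add, map_add, hx, hy]
  | tmul m n =>
    rw [PreTensor.op_smul_tmul, preMap_tmul, preMap_tmul, PreTensor.op_smul_tmul, g.map_op_smul]

theorem preMap_symm (z : PreTensor M N) : preMap f.symm g.symm (preMap f g z) = z := by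
  induction z using PreTensor.induction with
  | add x y hx hy => simp only [map_add, hx, hy]
  | tmul m n =>
    rw [preMap_tmul, preMap_tmul]; simp [symm]

/-- `f ⊗ g` as a linear isometry. -/
noncomputable def preMapIsom : PreTensor M N →ₗᵢ[ℂ] PreTensor M' N' where
  toLinearMap := preMap f g
  norm_map' z := by
    rw [PreTensor.norm_def, PreTensor.norm_def, preMap_leftForm]

/-- `f ⊗ g` on the completions. -/
noncomputable def completedMap : Completion (PreTensor M N) → Completion (PreTensor M' N') :=
  Completion.map (preMapIsom f g)

theorem completedMap_coe (z : PreTensor M N) :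
    completedMap f g (z : Completion (PreTensor M N)) = (preMap f g z : PreTensor M' N') :=
  Completion.map_coe (preMapIsom f g).isometry.uniformContinuous z

theorem continuous_completedMap : Continuous (completedMap f g) := Completion.continuous_map

theorem completedMap_symm (z : Completion (PreTensor M N)) :
    completedMap f.symm g.symm (completedMap f g z) = z := by
  induction z using Completion.induction_on with
  | hp =>
    exact isClosed_eq ((continuous_completedMap _ _).comp (continuous_completedMap _ _))
      continuous_id
  | ih z => rw [completedMap_coe, completedMap_coe, preMap_symm]

/-- Isomorphisms `M ≅ M'` and `N ≅ N'` induce `M ⊗ N ≅ M' ⊗ N'`. -/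
noncomputable def tensorMap : Iso (M.tensor N) (M'.tensor N') where
  toEquiv :=
    { toFun := completedMap f g
      invFun := completedMap f.symm g.symm
      left_inv := completedMap_symm f g
      right_inv := completedMap_symm f.symm g.symm
      map_add' := fun x y => by
        refine Completion.induction_on₂ (p := fun x y => completedMap f g (x + y)
          = completedMap f g x + completedMap f g y) x y ?_ fun x y => ?_
        · exact isClosed_eq ((continuous_completedMap f g).comp continuous_add)
            (((continuous_completedMap f g).comp continuous_fst).add
              ((continuous_completedMap f g).comp continuous_snd))
        · rw [← Completion.coe_add, completedMap_coe, completedMap_coe, completedMap_coe, map_add,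
            Completion.coe_add]
      map_smul' := fun a x => by
        refine Completion.induction_on (p := fun x => completedMap f g (a • x)
          = a • completedMap f g x) x ?_ fun x => ?_
        · exact isClosed_eq ((continuous_completedMap f g).comp (continuous_const_smul a))
            ((continuous_const_smul a).comp (continuous_completedMap f g))
        · rw [← Completion.coe_smul, completedMap_coe, completedMap_coe, preMap_smul,
            Completion.coe_smul] }
  map_op_smul a x := by
    refine Completion.induction_on (p := fun x => completedMap f g (op a • x)
      = op a • completedMap f g x) x ?_ fun x => ?_
    · exact isClosed_eq ((continuous_completedMap f g).comp (continuous_const_smul (op a)))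
        ((continuous_const_smul (op a)).comp (continuous_completedMap f g))
    · rw [← Completion.coe_smul, completedMap_coe, completedMap_coe, preMap_op_smul,
        Completion.coe_smul]
  map_leftInner x y := by
    refine Completion.induction_on₂ (p := fun x y => PreTensor.leftExt M' N' (completedMap f g x)
      (completedMap f g y) = PreTensor.leftExt M N x y) x y ?_ fun x y => ?_
    · exact isClosed_eq (PreTensor.continuous_leftExt₂ M' N'
        ((continuous_completedMap f g).comp continuous_fst)
        ((continuous_completedMap f g).comp continuous_snd)) (PreTensor.continuous_leftExt M N)
    · rw [completedMap_coe, completedMap_coe, PreTensor.leftExt_coe, PreTensor.leftExt_coe,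
        preMap_leftForm]
  map_rightInner x y := by
    refine Completion.induction_on₂ (p := fun x y => PreTensor.rightExt M' N' (completedMap f g x)
      (completedMap f g y) = PreTensor.rightExt M N x y) x y ?_ fun x y => ?_
    · exact isClosed_eq (PreTensor.continuous_rightExt₂ M' N'
        ((continuous_completedMap f g).comp continuous_fst)
        ((continuous_completedMap f g).comp continuous_snd)) (PreTensor.continuous_rightExt M N)
    · rw [completedMap_coe, completedMap_coe, PreTensor.rightExt_coe, PreTensor.rightExt_coe,
        preMap_rightForm]

end Iso

instance setoid (A : Type u) [CStarAlgebra A] : Setoid (HilbertBimodule A) where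
  r M N := Nonempty (Iso M N)
  iseqv := ⟨fun M => ⟨Iso.refl M⟩, fun ⟨f⟩ => ⟨f.symm⟩, fun ⟨f⟩ ⟨g⟩ => ⟨f.trans g⟩⟩

end HilbertBimodule

/-- `S(A)`: isomorphism classes of associative Hilbert `C*`-`A`-`A`-bimodules. -/
def S (A : Type u) [CStarAlgebra A] : Type (u + 1) := Quotient (HilbertBimodule.setoid A)

namespace S

/-- The class `[M]`. -/
def mk {A : Type u} [CStarAlgebra A] (M : HilbertBimodule A) : S A := Quotient.mk _ M

/-- The product `[M] [N] = [M ⊗_A N]`. -/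
noncomputable instance (A : Type u) [CStarAlgebra A] : Mul (S A) where
  mul := Quotient.map₂ HilbertBimodule.tensor fun _ _ ⟨f⟩ _ _ ⟨g⟩ => ⟨f.tensorMap g⟩

end S

open scoped NNReal ComplexConjugate

/-- `H_X = ℓ²(X)`. -/
abbrev HX (X : Type u) : Type u := lp (fun _ : X => ℂ) 2

/-- `𝔹(H_X)`. -/
abbrev BX (X : Type u) : Type u := HX X →L[ℂ] HX X

open Classical in
/-- The basis vector `δ_x`. -/
noncomputable def delta {X : Type u} (x : X) : HX X := lp.single 2 x 1

/-- `T_{x,y} = (δ_y, T δ_x)`. -/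
noncomputable def entry {X : Type u} (T : BX X) (x y : X) : ℂ := inner ℂ (delta y) (T (delta x))

/-- `T_{x,y} = 0` whenever `ρ x y > L`. -/
def HasPropagation {X : Type u} (ρ : X → X → ℝ) (L : ℝ) (T : BX X) : Prop :=
  ∀ x y, L < ρ x y → entry T x y = 0

section propagation

variable {X : Type u}

theorem inner_delta (x : X) (v : HX X) : inner ℂ (delta x) v = v x := by
  classical
  simpa [delta] using lp.inner_single_left (𝕜 := ℂ) x (1 : ℂ) v

theorem entry_star (T : BX X) (x y : X) : entry (star T) x y = conj (entry T y x) := by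
  rw [entry, entry, ContinuousLinearMap.star_eq_adjoint, ContinuousLinearMap.adjoint_inner_right,
    inner_conj_symm]

theorem entry_mul (T T' : BX X) (x y : X) : entry (T * T') x y = ∑' z, entry T z y * entry T' x z := by
  have h1 : entry (T * T') x y = inner ℂ (star T (delta y)) (T' (delta x)) := by
    rw [ContinuousLinearMap.star_eq_adjoint, ContinuousLinearMap.adjoint_inner_left]; rfl
  rw [h1, lp.inner_eq_tsum]
  refine tsum_congr fun z => ?_
  have h2 : entry T' x z = T' (delta x) z := inner_delta z _
  have h3 : entry T z y = conj (star T (delta y) z) := by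
    rw [← inner_delta z, ← entry, entry_star, Complex.conj_conj]
  rw [h2, h3, RCLike.inner_apply, mul_comm]

variable {ρ σ τ : X → X → ℝ} {L L' : ℝ} {T T' : BX X}

theorem HasPropagation.mono (h : HasPropagation ρ L T) (hL : L ≤ L') : HasPropagation ρ L' T :=
  fun x y hxy => h x y (hL.trans_lt hxy)

theorem HasPropagation.add (h : HasPropagation ρ L T) (h' : HasPropagation ρ L T') :
    HasPropagation ρ L (T + T') := fun x y hxy => by
  have e1 := h x y hxy
  have e2 := h' x y hxy
  rw [entry] at *
  rw [add_apply, inner_add_right, e1, e2, add_zero]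

theorem HasPropagation.smul (c : ℂ) (h : HasPropagation ρ L T) :
    HasPropagation ρ L (c • T) := fun x y hxy => by
  have e1 := h x y hxy
  rw [entry] at *
  rw [smul_apply, inner_smul_right, e1, mul_zero]

theorem hasPropagation_zero : HasPropagation ρ L (0 : BX X) := fun x y _ => by simp [entry]

theorem HasPropagation.star (h : HasPropagation ρ L T) :
    HasPropagation (fun x y => ρ y x) L (star T) := fun x y hxy => by
  rw [entry_star, h y x hxy, map_zero]

theorem HasPropagation.mul (h : HasPropagation ρ L T) (h' : HasPropagation σ L' T')
    (ht : ∀ x z y, τ x y ≤ σ x z + ρ z y) : HasPropagation τ (L + L') (T * T') := fun x y hxy => by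
  rw [entry_mul]
  have : ∀ z, entry T z y * entry T' x z = 0 := fun z => by
    rcases lt_or_ge L (ρ z y) with h1 | h1
    · rw [h z y h1, zero_mul]
    · rw [h' x z (by linarith [ht x z y]), mul_zero]
  simp [this]

/-- The space of all operators of finite propagation with respect to `ρ`. -/
def finPropSubmodule (ρ : X → X → ℝ) : Submodule ℂ (BX X) where
  carrier := {T | ∃ L, HasPropagation ρ L T}
  add_mem' := by
    rintro T T' ⟨L, h⟩ ⟨L', h'⟩
    exact ⟨max L L', (h.mono (le_max_left _ _)).add (h'.mono (le_max_right _ _))⟩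
  zero_mem' := ⟨0, hasPropagation_zero⟩
  smul_mem' c T := fun ⟨L, h⟩ => ⟨L, h.smul c⟩

theorem finPropSubmodule_le (h : ∀ L, ∃ L', ∀ x y, ρ x y ≤ L → σ x y ≤ L') :
    finPropSubmodule ρ ≤ finPropSubmodule σ := by
  rintro T ⟨L, hT⟩
  obtain ⟨L', h'⟩ := h L
  exact ⟨L', fun x y hxy => hT x y (lt_of_not_ge fun hc => hxy.not_ge (h' x y hc))⟩

end propagation

/-- The distance as a nonnegative real. -/
def ndist {Z : Type*} (m : MetricSpace Z) (x y : Z) : ℝ≥0 := ⟨m.dist x y, dist_nonneg⟩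

/-- Coarse equivalence of two metrics on `Z`: there is a homeomorphism `φ` of `[0, ∞)` with
`φ⁻¹(b(x, y)) ≤ m(x, y) ≤ φ(b(x, y))` for all `x, y`. -/
def CoarselyEquivalent {Z : Type*} (m b : MetricSpace Z) : Prop :=
  ∃ φ : ℝ≥0 ≃ₜ ℝ≥0, ∀ x y,
    φ.symm (ndist b x y) ≤ ndist m x y ∧ ndist m x y ≤ φ (ndist b x y)

section coarse

theorem homeomorph_strictMono (φ : ℝ≥0 ≃ₜ ℝ≥0) : StrictMono φ := by
  rcases φ.continuous.strictMono_of_inj φ.injective with h | h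
  · exact h
  · obtain ⟨x, hx⟩ := φ.surjective (φ 0 + 1)
    have := h.antitone (zero_le (a := x))
    rw [hx] at this
    exact absurd this (not_le.2 (lt_add_one _))

theorem homeomorph_zero (φ : ℝ≥0 ≃ₜ ℝ≥0) : φ 0 = 0 := by
  obtain ⟨x, hx⟩ := φ.surjective 0
  exact le_antisymm (((homeomorph_strictMono φ).monotone (zero_le (a := x))).trans hx.le) (zero_le)

variable {Z : Type*} {m b c : MetricSpace Z}

theorem CoarselyEquivalent.refl (m : MetricSpace Z) : CoarselyEquivalent m m :=
  ⟨Homeomorph.refl _, fun _ _ => ⟨le_rfl, le_rfl⟩⟩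

theorem symm_le_iff (φ : ℝ≥0 ≃ₜ ℝ≥0) (s t : ℝ≥0) : φ.symm s ≤ t ↔ s ≤ φ t := by
  rw [← (homeomorph_strictMono φ).le_iff_le, Homeomorph.apply_symm_apply]

theorem CoarselyEquivalent.symm (h : CoarselyEquivalent m b) : CoarselyEquivalent b m := by
  obtain ⟨φ, h⟩ := h
  exact ⟨φ, fun x y => ⟨(symm_le_iff φ _ _).2 (h x y).2, (symm_le_iff φ _ _).1 (h x y).1⟩⟩

theorem CoarselyEquivalent.trans (h : CoarselyEquivalent m b) (h' : CoarselyEquivalent b c) :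
    CoarselyEquivalent m c := by
  obtain ⟨φ, h⟩ := h
  obtain ⟨ψ, h'⟩ := h'
  have hφ := homeomorph_strictMono φ
  have hψ := homeomorph_strictMono ψ
  let χ : ℝ≥0 → ℝ≥0 := fun t => φ (ψ t) + ψ (φ t)
  have hmono : StrictMono χ := fun s t hst => add_lt_add (hφ (hψ hst)) (hψ (hφ hst))
  have hcont : Continuous χ := by fun_prop
  have htop : Tendsto χ atTop atTop := by
    refine tendsto_atTop_mono (f := fun t => φ (ψ t)) (fun t => le_self_add) ?_
    exact (hφ.comp hψ).monotone.tendsto_atTop_atTop fun t =>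
      ⟨ψ.symm (φ.symm t), by simp⟩
  have hbot : Tendsto χ atBot atBot := by
    have h0 : χ ⊥ = ⊥ := by
      change φ (ψ 0) + ψ (φ 0) = 0
      simp only [homeomorph_zero, add_zero]
    rw [OrderBot.atBot_eq, tendsto_pure]
    exact h0
  have hsurj := hcont.surjective htop hbot
  let e := (hmono.orderIsoOfSurjective χ hsurj).toHomeomorph
  refine ⟨e, fun x y => ⟨(symm_le_iff e _ _).2 ?_, ?_⟩⟩
  · have h1 := (symm_le_iff φ _ _).1 (h x y).1
    have h2 := (symm_le_iff ψ _ _).1 (h' x y).1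
    exact (h2.trans (hψ.monotone h1)).trans le_add_self
  · exact ((h x y).2.trans (hφ.monotone (h' x y).2)).trans le_self_add

theorem CoarselyEquivalent.bound (h : CoarselyEquivalent m b) (L : ℝ) :
    ∃ L' : ℝ, ∀ x y, b.dist x y ≤ L → m.dist x y ≤ L' := by
  obtain ⟨φ, h⟩ := h
  refine ⟨φ L.toNNReal, fun x y hxy => ?_⟩
  have h1 : ndist b x y ≤ L.toNNReal := NNReal.coe_le_coe.1 (hxy.trans (Real.le_coe_toNNReal L))
  exact NNReal.coe_le_coe.2 ((h x y).2.trans ((homeomorph_strictMono φ).monotone h1))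

end coarse

noncomputable section roe

variable {X : Type u}

/-- The `*`-algebra of bounded operators on `ℓ²(X)` of finite propagation. -/
def finPropAlgebra (b : MetricSpace X) : StarSubalgebra ℂ (BX X) where
  carrier := {T | ∃ L, HasPropagation b.dist L T}
  add_mem' := (finPropSubmodule b.dist).add_mem'
  mul_mem' := by
    rintro T T' ⟨L, h⟩ ⟨L', h'⟩
    exact ⟨L + L', h.mul h' fun x z y => b.dist_triangle x z y⟩
  algebraMap_mem' c := ⟨0, fun x y hxy => by
    classical
    have hne : x ≠ y := fun e => by rw [e, b.dist_self] at hxy; exact lt_irrefl _ hxy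
    rw [entry, ContinuousLinearMap.algebraMap_apply, inner_smul_right, inner_delta, delta,
      lp.single_apply_ne _ _ _ hne.symm, mul_zero]⟩
  star_mem' := by
    rintro T ⟨L, h⟩
    refine ⟨L, fun x y hxy => h.star x y ?_⟩
    rwa [b.dist_comm] at hxy

/-- The uniform Roe algebra `C*_u(X)` of the metric space `(X, b)`. -/
def uniformRoe (b : MetricSpace X) : StarSubalgebra ℂ (BX X) := (finPropAlgebra b).topologicalClosure

instance (b : MetricSpace X) : IsClosed (uniformRoe b : Set (BX X)) :=
  (finPropAlgebra b).isClosed_topologicalClosure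

theorem mem_uniformRoe {b : MetricSpace X} {T : BX X} :
    T ∈ uniformRoe b ↔ T ∈ closure {T : BX X | ∃ L, HasPropagation b.dist L T} := Iff.rfl

/-- `𝓜(X)`: the metrics on the double `X × {0, 1}` whose restriction to each copy of `X` is the
given metric, with non-zero distance between the two copies. -/
structure DoubleMetric (b : MetricSpace X) where
  metric : MetricSpace (X × Fin 2)
  restrict : ∀ i x y, metric.dist (x, i) (y, i) = b.dist x y
  separated : ∃ ε > 0, ∀ x y, ε ≤ metric.dist (x, 0) (y, 1)

variable {b : MetricSpace X}

/-- The distance from a point of the first copy to a point of the second copy. -/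
def DoubleMetric.cross (d : DoubleMetric b) (x y : X) : ℝ := d.metric.dist (x, 0) (y, 1)

theorem DoubleMetric.cross_le_right (d : DoubleMetric b) (x z y : X) :
    d.cross x y ≤ d.cross x z + b.dist z y := by
  rw [← d.restrict 1]; exact d.metric.dist_triangle _ _ _

theorem DoubleMetric.cross_le_left (d : DoubleMetric b) (x z y : X) :
    d.cross x y ≤ b.dist x z + d.cross z y := by
  rw [← d.restrict 0]; exact d.metric.dist_triangle _ _ _

theorem DoubleMetric.dist_le_left (d : DoubleMetric b) (x z y : X) :
    b.dist x z ≤ d.cross x y + d.cross z y := by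
  have := d.metric.dist_triangle (x, 0) (y, 1) (z, 0)
  rwa [d.restrict, d.metric.dist_comm (y, 1)] at this

theorem DoubleMetric.dist_le_right (d : DoubleMetric b) (x z y : X) :
    b.dist x z ≤ d.cross y x + d.cross y z := by
  have := d.metric.dist_triangle (x, 1) (y, 0) (z, 1)
  rwa [d.restrict, d.metric.dist_comm (x, 1)] at this

/-- `M_d(X)`: the norm closure of the bounded operators from `ℓ²` of the first copy to `ℓ²` of the
second copy of finite propagation with respect to `d`. -/
def roeModule (d : DoubleMetric b) : Submodule ℂ (BX X) :=
  (finPropSubmodule d.cross).topologicalClosure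

theorem mul_mem_roeModule (d : DoubleMetric b) {a m : BX X} (ha : a ∈ uniformRoe b)
    (hm : m ∈ roeModule d) : a * m ∈ roeModule d :=
  map_mem_closure₂ continuous_mul ha hm fun _ ⟨L, h⟩ _ ⟨L', h'⟩ =>
    ⟨L + L', h.mul h' d.cross_le_right⟩

theorem mul_mem_roeModule' (d : DoubleMetric b) {a m : BX X} (ha : a ∈ uniformRoe b)
    (hm : m ∈ roeModule d) : m * a ∈ roeModule d :=
  map_mem_closure₂ continuous_mul hm ha fun _ ⟨L, h⟩ _ ⟨L', h'⟩ =>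
    ⟨L + L', h.mul h' d.cross_le_left⟩

theorem mul_star_mem (d : DoubleMetric b) {m n : BX X} (hm : m ∈ roeModule d)
    (hn : n ∈ roeModule d) : m * star n ∈ uniformRoe b := by
  have hc : Continuous (Function.uncurry fun m n : BX X => m * star n) := by
    have h1 : Continuous fun p : BX X × BX X => p.1 * star p.2 := by fun_prop
    exact h1
  refine map_mem_closure₂ (f := fun m n : BX X => m * star n) hc hm hn ?_
  rintro m ⟨L, h⟩ n ⟨L', h'⟩
  exact ⟨L + L', h.mul h'.star fun x z y => d.dist_le_right x y z⟩

theorem star_mul_mem (d : DoubleMetric b) {m n : BX X} (hm : m ∈ roeModule d)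
    (hn : n ∈ roeModule d) : star m * n ∈ uniformRoe b := by
  have hc : Continuous (Function.uncurry fun m n : BX X => star m * n) := by
    have h1 : Continuous fun p : BX X × BX X => star p.1 * p.2 := by fun_prop
    exact h1
  have hm' : m ∈ closure {T : BX X | ∃ L, HasPropagation d.cross L T} := hm
  have hn' : n ∈ closure {T : BX X | ∃ L, HasPropagation d.cross L T} := hn
  refine map_mem_closure₂ (f := fun m n : BX X => star m * n)
    (u := {T : BX X | ∃ L, HasPropagation b.dist L T}) hc hm' hn' ?_
  rintro m ⟨L, h⟩ n ⟨L', h'⟩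
  have hp : HasPropagation b.dist (L + L') (star m * n) :=
    HasPropagation.mul (ρ := fun x y => d.cross y x) (σ := d.cross) h.star h'
      fun x z y => d.dist_le_left x y z
  exact ⟨L + L', hp⟩

/-- `C*_u(X)` acts on `M_d(X)` on both sides by composition of operators. -/
instance roeLeft (d : DoubleMetric b) : Module (uniformRoe b) (roeModule d) where
  smul a m := ⟨a.1 * m.1, mul_mem_roeModule d a.2 m.2⟩
  one_smul m := Subtype.ext (one_mul m.1)
  mul_smul a a' m := Subtype.ext (mul_assoc a.1 a'.1 m.1)
  smul_zero a := Subtype.ext (mul_zero a.1)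
  smul_add a m n := Subtype.ext (mul_add a.1 m.1 n.1)
  add_smul a a' m := Subtype.ext (add_mul a.1 a'.1 m.1)
  zero_smul m := Subtype.ext (zero_mul m.1)

instance roeRight (d : DoubleMetric b) : Module (uniformRoe b)ᵐᵒᵖ (roeModule d) where
  smul a m := ⟨m.1 * a.unop.1, mul_mem_roeModule' d a.unop.2 m.2⟩
  one_smul m := Subtype.ext (mul_one m.1)
  mul_smul a a' m := Subtype.ext (mul_assoc m.1 a'.unop.1 a.unop.1).symm
  smul_zero a := Subtype.ext (zero_mul a.unop.1)
  smul_add a m n := Subtype.ext (add_mul m.1 n.1 a.unop.1)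
  add_smul a a' m := Subtype.ext (mul_add m.1 a.unop.1 a'.unop.1)
  zero_smul m := Subtype.ext (mul_zero m.1)

theorem isClosed_roeModule (d : DoubleMetric b) : IsClosed (roeModule d : Set (BX X)) :=
  Submodule.isClosed_topologicalClosure _

/-- `M_d(X)` as an associative Hilbert `C*`-bimodule over `C*_u(X)`, with the left inner product
`m n*` and the right inner product `m* n`. -/
def roeBimodule (d : DoubleMetric b) : HilbertBimodule (uniformRoe b) where
  carrier := roeModule d
  complete := (isClosed_roeModule d).completeSpace_coe
  left_tower := ⟨fun c a m => Subtype.ext (smul_mul_assoc c a.1 m.1)⟩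
  right_tower := ⟨fun c a m => Subtype.ext (by
    change m.1 * (c • (a.unop.1 : BX X)) = c • (m.1 * (a.unop.1 : BX X))
    exact mul_smul_comm c m.1 (a.unop.1 : BX X))⟩
  smulComm := ⟨fun a a' m => Subtype.ext (mul_assoc a.1 m.1 a'.unop.1).symm⟩
  leftInner m n := ⟨m.1 * star n.1, mul_star_mem d m.2 n.2⟩
  rightInner m n := ⟨star m.1 * n.1, star_mul_mem d m.2 n.2⟩
  leftInner_add x y z := Subtype.ext (add_mul x.1 y.1 (star z.1))
  leftInner_smul a x y := Subtype.ext (mul_assoc a.1 x.1 (star y.1))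
  leftInner_star x y := Subtype.ext (by
    change star (x.1 * star y.1) = y.1 * star x.1
    rw [star_mul, star_star])
  leftInner_pos x := pos_of_subalgebra _ ⟨star x.1, by rw [star_star]⟩
  rightInner_add x y z := Subtype.ext (mul_add (star x.1) y.1 z.1)
  rightInner_smul a x y := Subtype.ext (mul_assoc (star x.1) y.1 a.1).symm
  rightInner_star x y := Subtype.ext (by
    change star (star x.1 * y.1) = star y.1 * x.1
    rw [star_mul, star_star])
  rightInner_pos x := pos_of_subalgebra _ ⟨x.1, rfl⟩
  rightInner_adj a x y := Subtype.ext (by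
    change star (a.1 * x.1) * y.1 = star x.1 * (star a.1 * y.1)
    rw [star_mul, mul_assoc])
  leftInner_adj a x y := Subtype.ext (by
    change (x.1 * a.1) * star y.1 = x.1 * star (y.1 * star a.1)
    rw [star_mul, star_star, mul_assoc])
  leftInner_norm := ⟨1, 1, one_pos, one_pos, fun x => by
    have : √‖x.1 * star x.1‖ = ‖x‖ := by
      rw [CStarRing.norm_self_mul_star (x := (x.1 : BX X)), Real.sqrt_mul_self (norm_nonneg _)]; rfl
    rw [one_mul]; exact ⟨this.ge, this.le⟩⟩
  rightInner_norm := ⟨1, 1, one_pos, one_pos, fun x => by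
    have : √‖star x.1 * x.1‖ = ‖x‖ := by
      rw [CStarRing.norm_star_mul_self (x := (x.1 : BX X)), Real.sqrt_mul_self (norm_nonneg _)]; rfl
    rw [one_mul]; exact ⟨this.ge, this.le⟩⟩
  assoc x y z := Subtype.ext (mul_assoc x.1 (star y.1) z.1)

theorem roeModule_eq {d d' : DoubleMetric b} (h : CoarselyEquivalent d.metric d'.metric) :
    roeModule d = roeModule d' := by
  refine congrArg Submodule.topologicalClosure (le_antisymm ?_ ?_)
  · refine finPropSubmodule_le fun L => ?_
    obtain ⟨L', h'⟩ := h.symm.bound L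
    exact ⟨L', fun x y => h' _ _⟩
  · refine finPropSubmodule_le fun L => ?_
    obtain ⟨L', h'⟩ := h.bound L
    exact ⟨L', fun x y => h' _ _⟩

/-- Equality of `M_d(X)` and `M_d'(X)` as an isomorphism of bimodules. -/
def roeBimoduleIso {d d' : DoubleMetric b} (h : roeModule d = roeModule d') :
    HilbertBimodule.Iso (roeBimodule d) (roeBimodule d') where
  toEquiv :=
    { toFun := fun m : roeModule d => (⟨m.1, h.le m.2⟩ : roeModule d')
      invFun := fun m : roeModule d' => (⟨m.1, h.ge m.2⟩ : roeModule d)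
      left_inv := fun _ => rfl
      right_inv := fun _ => rfl
      map_add' := fun _ _ => rfl
      map_smul' := fun _ _ => rfl }
  map_op_smul _ _ := rfl
  map_leftInner _ _ := rfl
  map_rightInner _ _ := rfl

instance doubleSetoid (b : MetricSpace X) : Setoid (DoubleMetric b) where
  r d d' := CoarselyEquivalent d.metric d'.metric
  iseqv := ⟨fun d => .refl d.metric, fun h => h.symm, fun h h' => h.trans h'⟩

/-- `M(X)`: coarse equivalence classes of metrics in `𝓜(X)`. -/
def MX (b : MetricSpace X) : Type u := Quotient (doubleSetoid b)

/-- The map `i : M(X) → S(C*_u(X))`, `i([d]) = [M_d(X)]`. -/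
def iMap (b : MetricSpace X) : MX b → S (uniformRoe b) :=
  Quotient.lift (fun d => S.mk (roeBimodule d)) fun _ _ h =>
    Quotient.sound ⟨roeBimoduleIso (roeModule_eq h)⟩

theorem uniformRoe_le {m b : MetricSpace X} (h : CoarselyEquivalent m b) :
    uniformRoe m ≤ uniformRoe b :=
  closure_mono (finPropSubmodule_le fun L =>
    let ⟨L', h'⟩ := h.symm.bound L
    ⟨L', fun x y => h' x y⟩)

/-- Coarsely equivalent metrics have the same uniform Roe algebra. -/
theorem uniformRoe_eq {m b : MetricSpace X} (h : CoarselyEquivalent m b) :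
    uniformRoe m = uniformRoe b :=
  le_antisymm (uniformRoe_le h) (uniformRoe_le h.symm)

end roe

theorem S_congr {B : Type u} [CStarAlgebra B] {s t : StarSubalgebra ℂ B}
    [hs : IsClosed (s : Set B)] [ht : IsClosed (t : Set B)] (h : s = t) : S s = S t := by
  subst h; rfl

/-- The identification of `S(s)` and `S(t)` for equal `C*`-subalgebras `s` and `t`. -/
def S.transport {B : Type u} [CStarAlgebra B] {s t : StarSubalgebra ℂ B}
    [hs : IsClosed (s : Set B)] [ht : IsClosed (t : Set B)] (h : s = t) : S s → S t :=
  cast (S_congr h)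

/-- `M_c(X)`: the intersection of the images of `M(X, b)` in `S(C*_u(X))` over all metrics `b` coarsely
equivalent to the given one. -/
def Mc {X : Type u} (m : MetricSpace X) : Set (S (uniformRoe m)) :=
  ⋂ (b : MetricSpace X) (h : CoarselyEquivalent b m),
    S.transport (uniformRoe_eq h) '' Set.range (iMap b)

/-- A subset `s` of a set with a multiplication is an inverse semigroup under this multiplication:
it is non-empty and closed under multiplication, the multiplication is associative on `s`, and each
`x ∈ s` has exactly one inverse in `s`. -/
structure IsInverseSubsemigroup {α : Type*} [Mul α] (s : Set α) : Prop where
  nonempty : s.Nonempty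
  mul_mem : ∀ x ∈ s, ∀ y ∈ s, x * y ∈ s
  mul_assoc : ∀ x ∈ s, ∀ y ∈ s, ∀ z ∈ s, x * y * z = x * (y * z)
  exists_unique_inv : ∀ x ∈ s, ∃! y, y ∈ s ∧ x * y * x = x ∧ y * x * y = y

end RoeBimodule

/-!
The set `M_c(X)` turns out to be a meet-semilattice: its elements are classes of closed two-sided ideals
of the uniform Roe algebra, and their product is the class of the intersection. Every element is thus
its own unique inverse.

*Classes are subspaces.* The uniform Roe algebra and all the modules `M_d(X)` contain the matrix units.
An isomorphism of bimodules commutes with compression by matrix units, so it multiplies all matrix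
entries by one and the same scalar; hence `M_d(X)` and `M_d'(X)` are isomorphic only if they are
equal as subspaces of `𝔹(ℓ²(X))` (`eq_of_mk_concreteBimodule_eq`). Moreover, equality of the norm closures
forces equality of the spaces of finite propagation operators
(`finPropSubmodule_eq_of_roeModule_eq`): if `d` is bounded and `d'` unbounded on a set of pairs, then
some partial isometry matching infinitely many such pairs is far from every operator of finite
propagation for `d'`. So `M_c(X)` is identified with the set of subspaces which, for *every* metric `b`
coarsely equivalent to the given one, are the finite propagation operators of some metric on the double
of `(X, b)` (`IsUniversal`, `mem_Mc_iff`). This description does not depend on the choice of the metric in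
its coarse class, which is the second claim (`transport_image_Mc`).

*Universality forces closeness to the diagonal.* A metric on the double of `(X, b)` matches points of the
two copies almost isometrically for `b`. If it matched points `x_k` with points `y_k` where `b(x_k, y_k)`
is unbounded, then adding `|h(x) - h(y)|` to `b`, for `h` the distance to the set of the `y_k`, would give
a coarsely equivalent metric for which this matching is no longer almost isometric
(`IsUniversal.dist_bound`).

*Products.* The bimodule tensor product of two subspaces of a `C*`-algebra is the closed span of their
products (`tensorMulIso`). The maximum of two metrics on the double is again such a metric, and its
finite propagation operators are those which have finite propagation for both. By closeness to the
diagonal, such an operator `T` satisfies `T = T P` for a projection `P` onto `ℓ²(A)`, where both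
metrics are bounded on the diagonal of `A`; so `T` is a product, and `[M_d] [M_d'] = [M_{max(d, d')}]`
(`mk_mul_mk_roeBimodule`). The metric `b(x, y) + 1` shows that `M_c(X)` is non-empty.
-/

namespace RoeBimodule

universe u

/-! ### Bimodules inside a `C*`-algebra -/

section concrete

variable {B : Type u} [CStarAlgebra B]

/-- `V` is a closed subspace of the `C*`-algebra `B` which is a bimodule over the subalgebra `s` under
multiplication and on which `v w*` and `v* w` take values in `s`. -/
structure IsConcreteBimodule (s : StarSubalgebra ℂ B) (V : Submodule ℂ B) : Prop where
  isClosed : IsClosed (V : Set B)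
  mul_mem : ∀ a ∈ s, ∀ v ∈ V, a * v ∈ V
  mul_mem' : ∀ a ∈ s, ∀ v ∈ V, v * a ∈ V
  mul_star_mem : ∀ v ∈ V, ∀ w ∈ V, v * star w ∈ s
  star_mul_mem : ∀ v ∈ V, ∀ w ∈ V, star v * w ∈ s

variable {s t : StarSubalgebra ℂ B} {V W U : Submodule ℂ B}

/-- Left multiplication of `s` on `V`. -/
abbrev IsConcreteBimodule.leftModule (h : IsConcreteBimodule s V) : Module s V where
  smul a m := ⟨a.1 * m.1, h.mul_mem _ a.2 _ m.2⟩
  one_smul m := Subtype.ext (one_mul m.1)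
  mul_smul a a' m := Subtype.ext (mul_assoc a.1 a'.1 m.1)
  smul_zero a := Subtype.ext (mul_zero a.1)
  smul_add a m n := Subtype.ext (mul_add a.1 m.1 n.1)
  add_smul a a' m := Subtype.ext (add_mul a.1 a'.1 m.1)
  zero_smul m := Subtype.ext (zero_mul m.1)

/-- Right multiplication of `s` on `V`. -/
abbrev IsConcreteBimodule.rightModule (h : IsConcreteBimodule s V) : Module sᵐᵒᵖ V where
  smul a m := ⟨m.1 * a.unop.1, h.mul_mem' _ a.unop.2 _ m.2⟩
  one_smul m := Subtype.ext (mul_one m.1)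
  mul_smul a a' m := Subtype.ext (mul_assoc m.1 a'.unop.1 a.unop.1).symm
  smul_zero a := Subtype.ext (zero_mul a.unop.1)
  smul_add a m n := Subtype.ext (add_mul m.1 n.1 a.unop.1)
  add_smul a a' m := Subtype.ext (mul_add m.1 a.unop.1 a'.unop.1)
  zero_smul m := Subtype.ext (mul_zero m.1)

/-- A concrete bimodule `V` as a Hilbert bimodule over `s`, with left inner product `v w*` and right
inner product `v* w`. Both inner products define the norm of `B`. -/
noncomputable def concreteBimodule [hs : IsClosed (s : Set B)] (h : IsConcreteBimodule s V) :
    HilbertBimodule s :=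
  letI := h.leftModule
  letI := h.rightModule
  { carrier := V
    complete := h.isClosed.completeSpace_coe
    left_tower := ⟨fun c a m => Subtype.ext (smul_mul_assoc c a.1 m.1)⟩
    right_tower := ⟨fun c a m => Subtype.ext (mul_smul_comm c m.1 (a.unop.1 : B))⟩
    smulComm := ⟨fun a a' m => Subtype.ext (mul_assoc a.1 m.1 a'.unop.1).symm⟩
    leftInner := fun m n => ⟨m.1 * star n.1, h.mul_star_mem _ m.2 _ n.2⟩
    rightInner := fun m n => ⟨star m.1 * n.1, h.star_mul_mem _ m.2 _ n.2⟩
    leftInner_add := fun x y z => Subtype.ext (add_mul x.1 y.1 (star z.1))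
    leftInner_smul := fun a x y => Subtype.ext (mul_assoc a.1 x.1 (star y.1))
    leftInner_star := fun x y => Subtype.ext (by
      change star (x.1 * star y.1) = y.1 * star x.1
      rw [star_mul, star_star])
    leftInner_pos := fun x => pos_of_subalgebra _ ⟨star x.1, by rw [star_star]⟩
    rightInner_add := fun x y z => Subtype.ext (mul_add (star x.1) y.1 z.1)
    rightInner_smul := fun a x y => Subtype.ext (mul_assoc (star x.1) y.1 a.1).symm
    rightInner_star := fun x y => Subtype.ext (by
      change star (star x.1 * y.1) = star y.1 * x.1
      rw [star_mul, star_star])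
    rightInner_pos := fun x => pos_of_subalgebra _ ⟨x.1, rfl⟩
    rightInner_adj := fun a x y => Subtype.ext (by
      change star (a.1 * x.1) * y.1 = star x.1 * (star a.1 * y.1)
      rw [star_mul, mul_assoc])
    leftInner_adj := fun a x y => Subtype.ext (by
      change (x.1 * a.1) * star y.1 = x.1 * star (y.1 * star a.1)
      rw [star_mul, star_star, mul_assoc])
    leftInner_norm := ⟨1, 1, one_pos, one_pos, fun x => by
      have : √‖x.1 * star x.1‖ = ‖x‖ := by
        rw [CStarRing.norm_self_mul_star (x := (x.1 : B)), Real.sqrt_mul_self (norm_nonneg _)]; rfl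
      rw [one_mul]; exact ⟨this.ge, this.le⟩⟩
    rightInner_norm := ⟨1, 1, one_pos, one_pos, fun x => by
      have : √‖star x.1 * x.1‖ = ‖x‖ := by
        rw [CStarRing.norm_star_mul_self (x := (x.1 : B)), Real.sqrt_mul_self (norm_nonneg _)]; rfl
      rw [one_mul]; exact ⟨this.ge, this.le⟩⟩
    assoc := fun x y z => Subtype.ext (mul_assoc x.1 (star y.1) z.1) }

theorem mk_concreteBimodule_congr [IsClosed (s : Set B)] (hV : IsConcreteBimodule s V)
    (hW : IsConcreteBimodule s W) (h : V = W) :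
    S.mk (concreteBimodule hV) = S.mk (concreteBimodule hW) := by
  subst h; rfl

theorem transport_mk_concreteBimodule [hs : IsClosed (s : Set B)] [ht : IsClosed (t : Set B)]
    (h : s = t) (hV : IsConcreteBimodule s V) (hW : IsConcreteBimodule t W) (hVW : V = W) :
    S.transport h (S.mk (concreteBimodule hV)) = S.mk (concreteBimodule hW) := by
  subst h; subst hVW; rfl

section tensor

open HilbertBimodule UniformSpace

variable [hs : IsClosed (s : Set B)] (hV : IsConcreteBimodule s V) (hW : IsConcreteBimodule s W)
  (hmul : ∀ v ∈ V, ∀ w ∈ W, v * w ∈ U)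

/-- `v ⊗ w ↦ v w` on the algebraic tensor product. -/
noncomputable def preMul :
    PreTensor (concreteBimodule hV) (concreteBimodule hW) →ₗ[ℂ] U :=
  TensorProduct.lift (LinearMap.mk₂ ℂ (fun (v : V) (w : W) => (⟨v.1 * w.1, hmul _ v.2 _ w.2⟩ : U))
    (fun x y z => Subtype.ext (add_mul x.1 y.1 z.1))
    (fun c x z => Subtype.ext (smul_mul_assoc c x.1 z.1))
    (fun x y z => Subtype.ext (mul_add x.1 y.1 z.1))
    (fun c x z => Subtype.ext (mul_smul_comm c x.1 z.1)))

theorem preMul_leftForm (z w : PreTensor (concreteBimodule hV) (concreteBimodule hW)) :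
    ((PreTensor.leftForm _ _ z w : s) : B)
      = (preMul hV hW hmul z : B) * star (preMul hV hW hmul w : B) := by
  induction z using PreTensor.induction with
  | add x y hx hy =>
    rw [map_add, map_add, LinearMap.add_apply, Submodule.coe_add, add_mul, ← hx, ← hy]; rfl
  | tmul m n =>
    induction w using PreTensor.induction with
    | add x y hx hy =>
      rw [map_add, map_add, Submodule.coe_add, star_add, mul_add, ← hx, ← hy]; rfl
    | tmul m' n' =>
      change (m.1 * (n.1 * star n'.1)) * star m'.1 = m.1 * n.1 * star (m'.1 * n'.1)
      rw [star_mul]; simp only [mul_assoc]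

theorem preMul_rightForm (z w : PreTensor (concreteBimodule hV) (concreteBimodule hW)) :
    ((PreTensor.rightForm _ _ z w : s) : B)
      = star (preMul hV hW hmul z : B) * (preMul hV hW hmul w : B) := by
  induction z using PreTensor.induction with
  | add x y hx hy =>
    rw [map_add, map_add, LinearMap.add_apply, Submodule.coe_add, star_add, add_mul, ← hx, ← hy]; rfl
  | tmul m n =>
    induction w using PreTensor.induction with
    | add x y hx hy =>
      rw [map_add, map_add, Submodule.coe_add, mul_add, ← hx, ← hy]; rfl
    | tmul m' n' =>
      change star n.1 * ((star m.1 * m'.1) * n'.1) = star (m.1 * n.1) * (m'.1 * n'.1)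
      rw [star_mul]; simp only [mul_assoc]

theorem preMul_smul (a : s) (z : PreTensor (concreteBimodule hV) (concreteBimodule hW)) :
    (preMul hV hW hmul (a • z) : B) = a.1 * preMul hV hW hmul z := by
  induction z using PreTensor.induction with
  | add x y hx hy =>
    rw [smul_add, map_add, map_add, Submodule.coe_add, Submodule.coe_add, mul_add, hx, hy]
  | tmul m n => exact mul_assoc a.1 m.1 n.1

theorem preMul_op_smul (a : s) (z : PreTensor (concreteBimodule hV) (concreteBimodule hW)) :
    (preMul hV hW hmul (op a • z) : B) = preMul hV hW hmul z * a.1 := by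
  induction z using PreTensor.induction with
  | add x y hx hy =>
    rw [smul_add, map_add, map_add, Submodule.coe_add, Submodule.coe_add, add_mul, hx, hy]
  | tmul m n => exact (mul_assoc m.1 n.1 a.1).symm

/-- Multiplication as a linear isometry from the algebraic tensor product. -/
noncomputable def preMulIsom :
    PreTensor (concreteBimodule hV) (concreteBimodule hW) →ₗᵢ[ℂ] U where
  toLinearMap := preMul hV hW hmul
  norm_map' z := by
    change ‖(preMul hV hW hmul z : B)‖ = ‖z‖
    have h1 : ‖PreTensor.leftForm _ _ z z‖
        = ‖(preMul hV hW hmul z : B)‖ * ‖(preMul hV hW hmul z : B)‖ := by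
      rw [← CStarRing.norm_self_mul_star, ← preMul_leftForm]; rfl
    rw [PreTensor.norm_def, h1, Real.sqrt_mul_self (norm_nonneg _)]

/-- Multiplication on the completed tensor product. -/
noncomputable def tensorMul :
    Completion (PreTensor (concreteBimodule hV) (concreteBimodule hW)) → U :=
  Completion.extension (preMul hV hW hmul)

theorem continuous_tensorMul (hU : IsConcreteBimodule s U) : Continuous (tensorMul hV hW hmul) :=
  haveI := hU.isClosed.completeSpace_coe
  Completion.continuous_extension

theorem tensorMul_coe (hU : IsConcreteBimodule s U)
    (z : PreTensor (concreteBimodule hV) (concreteBimodule hW)) :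
    tensorMul hV hW hmul z = preMul hV hW hmul z :=
  haveI := hU.isClosed.completeSpace_coe
  Completion.extension_coe (preMulIsom hV hW hmul).isometry.uniformContinuous z

theorem isometry_tensorMul (hU : IsConcreteBimodule s U) : Isometry (tensorMul hV hW hmul) :=
  haveI := hU.isClosed.completeSpace_coe
  (preMulIsom hV hW hmul).isometry.completion_extension

theorem tensorMul_surjective (hU : IsConcreteBimodule s U)
    (hdense : (U : Set B) ⊆
      closure (Submodule.span ℂ (Set.image2 (· * ·) (V : Set B) (W : Set B)))) :
    Function.Surjective (tensorMul hV hW hmul) := by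
  have := hU.isClosed.completeSpace_coe
  have hcl : IsClosed (Set.range (tensorMul hV hW hmul)) :=
    (isometry_tensorMul hV hW hmul hU).isClosedEmbedding.isClosed_range
  have hspan : Submodule.span ℂ (Set.image2 (· * ·) (V : Set B) (W : Set B))
      ≤ (LinearMap.range (preMul hV hW hmul)).map U.subtype := by
    rw [Submodule.span_le]
    rintro _ ⟨v, hv, w, hw, rfl⟩
    exact ⟨_, ⟨PreTensor.tmul (M := concreteBimodule hV) (N := concreteBimodule hW)
      (⟨v, hv⟩ : V) (⟨w, hw⟩ : W), rfl⟩, rfl⟩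
  intro u
  change u ∈ Set.range (tensorMul hV hW hmul)
  rw [← hcl.closure_eq, closure_subtype]
  refine closure_mono ?_ (hdense u.2)
  intro x hx
  obtain ⟨_, ⟨z, rfl⟩, rfl⟩ := hspan hx
  exact ⟨_, ⟨z, tensorMul_coe hV hW hmul hU z⟩, rfl⟩

/-- Multiplication identifies `V ⊗ W` with the closed span `U` of the products `v w`. -/
noncomputable def tensorMulIso (hU : IsConcreteBimodule s U)
    (hdense : (U : Set B) ⊆
      closure (Submodule.span ℂ (Set.image2 (· * ·) (V : Set B) (W : Set B)))) :
    HilbertBimodule.Iso ((concreteBimodule hV).tensor (concreteBimodule hW))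
      (concreteBimodule hU) where
  toEquiv := LinearEquiv.ofBijective
    (M := ((concreteBimodule hV).tensor (concreteBimodule hW)).carrier)
    (M₂ := (concreteBimodule hU).carrier)
    { toFun := tensorMul hV hW hmul
      map_add' := fun x y => by
        refine Completion.induction_on₂ (p := fun x y => tensorMul hV hW hmul (x + y)
          = tensorMul hV hW hmul x + tensorMul hV hW hmul y) x y ?_ fun x y => ?_
        · have hc := continuous_tensorMul hV hW hmul hU
          exact isClosed_eq (hc.comp continuous_add)
            ((hc.comp continuous_fst).add (hc.comp continuous_snd))
        · rw [← Completion.coe_add, tensorMul_coe hV hW hmul hU, tensorMul_coe hV hW hmul hU,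
            tensorMul_coe hV hW hmul hU, map_add]
      map_smul' := fun a x => by
        refine Subtype.ext (Completion.induction_on
          (p := fun x => (tensorMul hV hW hmul (a • x) : B)
            = a.1 * tensorMul hV hW hmul x) x ?_ fun x => ?_)
        · have hc := continuous_subtype_val.comp (continuous_tensorMul hV hW hmul hU)
          exact isClosed_eq (hc.comp (continuous_const_smul a)) (continuous_const.mul hc)
        · rw [← Completion.coe_smul, tensorMul_coe hV hW hmul hU, tensorMul_coe hV hW hmul hU,
            preMul_smul] }
    ⟨(isometry_tensorMul hV hW hmul hU).injective, tensorMul_surjective hV hW hmul hU hdense⟩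
  map_op_smul a x := by
    refine Subtype.ext (Completion.induction_on
      (p := fun x => (tensorMul hV hW hmul (op a • x) : B)
        = tensorMul hV hW hmul x * a.1) x ?_ fun x => ?_)
    · have hc := continuous_subtype_val.comp (continuous_tensorMul hV hW hmul hU)
      exact isClosed_eq (hc.comp (continuous_const_smul (op a))) (hc.mul continuous_const)
    · rw [← Completion.coe_smul, tensorMul_coe hV hW hmul hU, tensorMul_coe hV hW hmul hU,
        preMul_op_smul]
  map_leftInner x y := by
    refine Subtype.ext (Completion.induction_on₂
      (p := fun x y => (tensorMul hV hW hmul x : B) * star (tensorMul hV hW hmul y : B)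
        = (PreTensor.leftExt _ _ x y : s)) x y ?_ fun x y => ?_)
    · have hc := continuous_subtype_val.comp (continuous_tensorMul hV hW hmul hU)
      exact isClosed_eq ((hc.comp continuous_fst).mul (hc.comp continuous_snd).star)
        (continuous_subtype_val.comp (PreTensor.continuous_leftExt _ _))
    · rw [tensorMul_coe hV hW hmul hU, tensorMul_coe hV hW hmul hU, PreTensor.leftExt_coe,
        preMul_leftForm]
  map_rightInner x y := by
    refine Subtype.ext (Completion.induction_on₂
      (p := fun x y => star (tensorMul hV hW hmul x : B) * (tensorMul hV hW hmul y : B)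
        = (PreTensor.rightExt _ _ x y : s)) x y ?_ fun x y => ?_)
    · have hc := continuous_subtype_val.comp (continuous_tensorMul hV hW hmul hU)
      exact isClosed_eq ((hc.comp continuous_fst).star.mul (hc.comp continuous_snd))
        (continuous_subtype_val.comp (PreTensor.continuous_rightExt _ _))
    · rw [tensorMul_coe hV hW hmul hU, tensorMul_coe hV hW hmul hU, PreTensor.rightExt_coe,
        preMul_rightForm]

theorem mk_mul_mk_concreteBimodule (hU : IsConcreteBimodule s U)
    (hmul : ∀ v ∈ V, ∀ w ∈ W, v * w ∈ U)
    (hdense : (U : Set B) ⊆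
      closure (Submodule.span ℂ (Set.image2 (· * ·) (V : Set B) (W : Set B)))) :
    S.mk (concreteBimodule hV) * S.mk (concreteBimodule hW) = S.mk (concreteBimodule hU) :=
  Quotient.sound ⟨tensorMulIso hV hW hmul hU hdense⟩

end tensor

end concrete

/-! ### Operators on `ℓ²(X)` -/

section operators

open scoped ComplexConjugate

variable {X : Type u}

theorem orthonormal_delta {ι : Type*} {f : ι → X} (hf : Function.Injective f) :
    Orthonormal ℂ fun i => delta (f i) := by
  classical
  rw [orthonormal_iff_ite]
  intro i j
  rw [inner_delta, delta, lp.single_apply, Pi.single_apply]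
  simp only [hf.eq_iff]

/-- The isometry `ℓ²(ι) → ℓ²(X)` with `δ_i ↦ δ_{f i}`. -/
noncomputable def pushIsometry {ι : Type*} {f : ι → X} (hf : Function.Injective f) :
    lp (fun _ : ι => ℂ) 2 →ₗᵢ[ℂ] HX X :=
  (orthonormal_delta hf).orthogonalFamily.linearIsometry

theorem pushIsometry_delta {ι : Type u} {f : ι → X} (hf : Function.Injective f) (i : ι) :
    pushIsometry hf (delta i) = delta (f i) := by
  classical
  rw [pushIsometry, delta, OrthogonalFamily.linearIsometry_apply_single]
  simp

variable {ι : Type u} {f g : ι → X}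

/-- The partial isometry of `ℓ²(X)` with `δ_{f i} ↦ δ_{g i}`, vanishing on `δ_x` for `x` outside the
range of `f`. -/
noncomputable def partialShift (hf : Function.Injective f) (hg : Function.Injective g) : BX X :=
  (pushIsometry hg).toContinuousLinearMap ∘L
    ContinuousLinearMap.adjoint (pushIsometry hf).toContinuousLinearMap

theorem adjoint_pushIsometry_apply (hf : Function.Injective f) (i : ι) (v : HX X) :
    ContinuousLinearMap.adjoint (pushIsometry hf).toContinuousLinearMap v i = v (f i) := by
  rw [← inner_delta i, ContinuousLinearMap.adjoint_inner_right]
  change inner ℂ (pushIsometry hf (delta i)) v = _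
  rw [pushIsometry_delta, inner_delta]

theorem delta_apply_self (x : X) : delta x x = 1 := by
  classical
  rw [delta, lp.single_apply_self]

theorem delta_apply_ne {x y : X} (h : y ≠ x) : delta x y = 0 := by
  classical
  rw [delta, lp.single_apply_ne _ _ _ h]

theorem entry_partialShift (hf : Function.Injective f) (hg : Function.Injective g) (x y : X) :
    entry (partialShift hf hg) x y = ∑' i, delta x (f i) * delta y (g i) := by
  have hy : ∀ i, conj (delta y (g i)) = delta y (g i) := fun i => by
    by_cases h : g i = y
    · rw [h, delta_apply_self, map_one]
    · rw [delta_apply_ne h, map_zero]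
  rw [entry, partialShift, ContinuousLinearMap.comp_apply,
    ← ContinuousLinearMap.adjoint_inner_left, lp.inner_eq_tsum]
  refine tsum_congr fun i => ?_
  rw [adjoint_pushIsometry_apply, adjoint_pushIsometry_apply, RCLike.inner_apply, hy]

theorem entry_partialShift_apply (hf : Function.Injective f) (hg : Function.Injective g) (i : ι) :
    entry (partialShift hf hg) (f i) (g i) = 1 := by
  rw [entry_partialShift, tsum_eq_single i, delta_apply_self, delta_apply_self, one_mul]
  intro j hj
  rw [delta_apply_ne (hf.ne hj), zero_mul]

theorem entry_partialShift_eq_zero (hf : Function.Injective f) (hg : Function.Injective g) {x y : X}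
    (h : ∀ i, ¬(f i = x ∧ g i = y)) : entry (partialShift hf hg) x y = 0 := by
  rw [entry_partialShift]
  refine (tsum_congr fun i => ?_).trans tsum_zero
  by_cases hx : f i = x
  · rw [delta_apply_ne (fun hy => h i ⟨hx, hy⟩), mul_zero]
  · rw [delta_apply_ne hx, zero_mul]

theorem hasPropagation_partialShift (hf : Function.Injective f) (hg : Function.Injective g)
    {ρ : X → X → ℝ} {L : ℝ} (h : ∀ i, ρ (f i) (g i) ≤ L) :
    HasPropagation ρ L (partialShift hf hg) := by
  intro x y hxy
  refine entry_partialShift_eq_zero hf hg fun i hi => ?_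
  have := h i
  rw [hi.1, hi.2] at this
  exact this.not_gt hxy

theorem entry_eq_apply (T : BX X) (x y : X) : entry T x y = T (delta x) y := inner_delta y _

/-- A bounded operator on `ℓ²(X)` is determined by its matrix. -/
theorem ext_entry {T T' : BX X} (h : ∀ x y, entry T x y = entry T' x y) : T = T' := by
  classical
  have hd : ∀ x, T (delta x) = T' (delta x) := fun x => by
    refine lp.ext (funext fun y => ?_)
    rw [← entry_eq_apply, ← entry_eq_apply, h]
  ext1 v
  have hv : HasSum (fun x => v x • delta x) v := by
    have := lp.hasSum_single (p := 2) (by norm_num) v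
    convert this using 2 with x
    rw [delta, ← lp.single_smul, smul_eq_mul, mul_one]
  have h1 := hv.mapL T
  have h2 := hv.mapL T'
  simp only [map_smul, hd] at h1 h2
  exact h1.unique h2

theorem norm_delta (x : X) : ‖delta x‖ = 1 :=
  (orthonormal_delta Function.injective_id).1 x

theorem norm_entry_le (T : BX X) (x y : X) : ‖entry T x y‖ ≤ ‖T‖ := by
  refine (norm_inner_le_norm _ _).trans ?_
  rw [norm_delta, one_mul]
  exact (T.le_opNorm _).trans (by rw [norm_delta, mul_one])

theorem entry_sub (T T' : BX X) (x y : X) : entry (T - T') x y = entry T x y - entry T' x y := by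
  rw [entry, entry, entry, sub_apply, inner_sub_right]

theorem entry_smul (c : ℂ) (T : BX X) (x y : X) : entry (c • T) x y = c * entry T x y := by
  rw [entry, entry, smul_apply, inner_smul_right]

/-- The matrix unit `δ_x ↦ δ_y`. -/
noncomputable def matrixUnit (x y : X) : BX X :=
  InnerProductSpace.rankOne ℂ (delta y) (delta x)

theorem hasPropagation_matrixUnit (ρ : X → X → ℝ) (x y : X) :
    HasPropagation ρ (ρ x y) (matrixUnit x y) := by
  intro x' y' h
  rw [entry, matrixUnit, InnerProductSpace.rankOne_apply, inner_smul_right, inner_delta, inner_delta]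
  by_cases hx : x = x'
  · by_cases hy : y' = y
    · subst hx; subst hy; exact absurd h (lt_irrefl _)
    · rw [delta_apply_ne hy, mul_zero]
  · rw [delta_apply_ne hx, zero_mul]

theorem matrixUnit_ne_zero (x y : X) : matrixUnit x y ≠ 0 := by
  rw [← norm_ne_zero_iff, matrixUnit, InnerProductSpace.norm_rankOne, norm_delta, norm_delta]
  norm_num

theorem matrixUnit_mul_mul_matrixUnit (x x₁ y y₁ : X) (T : BX X) :
    matrixUnit y y₁ * T * matrixUnit x₁ x = entry T x y • matrixUnit x₁ y₁ := by
  ext1 v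
  simp only [matrixUnit, mul_apply_eq_comp, InnerProductSpace.rankOne_apply, map_smul,
    entry, smul_apply, smul_smul]
  rw [mul_comm]

/-- The projection of `ℓ²(X)` onto `ℓ²(A)`. -/
noncomputable def proj (A : Set X) : BX X :=
  partialShift (f := ((↑) : A → X)) Subtype.val_injective Subtype.val_injective

theorem mul_proj_eq {A : Set X} {T : BX X} (h : ∀ x y, x ∉ A → entry T x y = 0) :
    T * proj A = T := by
  refine ext_entry fun x y => ?_
  rw [entry_mul, tsum_eq_single x]
  · by_cases hx : x ∈ A
    · have := entry_partialShift_apply (f := ((↑) : A → X)) Subtype.val_injective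
        Subtype.val_injective ⟨x, hx⟩
      rw [proj, this, mul_one]
    · rw [h x y hx, zero_mul]
  · intro z hz
    rw [proj, entry_partialShift_eq_zero, mul_zero]
    rintro i ⟨h1, h2⟩
    exact hz (h2.symm.trans h1)

/-- If `s` contains the matrix units, an isomorphism between concrete bimodules is a scalar multiple of
the identity, so isomorphic bimodules are equal. -/
theorem le_of_iso_concreteBimodule {s : StarSubalgebra ℂ (BX X)} [hs : IsClosed (s : Set (BX X))]
    {V W : Submodule ℂ (BX X)} (hV : IsConcreteBimodule s V) (hW : IsConcreteBimodule s W)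
    (hsu : ∀ x y, matrixUnit x y ∈ s) (hVu : ∀ x, matrixUnit x x ∈ V)
    (φ : HilbertBimodule.Iso (concreteBimodule hV) (concreteBimodule hW)) : V ≤ W := by
  rcases isEmpty_or_nonempty X with hX | ⟨⟨o⟩⟩
  · intro T _
    rw [ext_entry (T := T) (T' := 0) fun x => hX.elim x]
    exact W.zero_mem
  let F : V → W := φ.toEquiv
  have hl : ∀ (a : s) (v : V), (F ⟨a.1 * v.1, hV.mul_mem _ a.2 _ v.2⟩ : BX X) = a.1 * F v :=
    fun a v => congrArg Subtype.val (φ.toEquiv.map_smul a v)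
  have hr : ∀ (a : s) (v : V), (F ⟨v.1 * a.1, hV.mul_mem' _ a.2 _ v.2⟩ : BX X) = F v * a.1 :=
    fun a v => congrArg Subtype.val (φ.map_op_smul a v)
  have hsm : ∀ (c : ℂ) (v : V), (F (c • v) : BX X) = c • (F v : BX X) := fun c v =>
    congrArg Subtype.val ((φ.toEquiv.toLinearMap.restrictScalars ℂ).map_smul c v)
  let E : V := ⟨matrixUnit o o, hVu o⟩
  -- Compressing by matrix units compares each entry of `F v` with the entry of `v`.
  have key : ∀ (v : V) (x y : X), entry v.1 x y • (F E : BX X)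
      = entry (F v).1 x y • matrixUnit o o := fun v x y => by
    let a : s := ⟨matrixUnit y o, hsu y o⟩
    let a' : s := ⟨matrixUnit o x, hsu o x⟩
    rw [← hsm, ← matrixUnit_mul_mul_matrixUnit x o y o]
    have h1 := hr a' ⟨a.1 * v.1, hV.mul_mem _ a.2 _ v.2⟩
    rw [hl a v] at h1
    refine Eq.trans (congrArg (fun w => (F w : BX X)) (Subtype.ext ?_)) h1
    exact (matrixUnit_mul_mul_matrixUnit x o y o v.1).symm
  set c := entry (F E).1 o o with hc
  have hE : (F E : BX X) = c • matrixUnit o o := by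
    have := key E o o
    have h1 : entry (matrixUnit o o) o o = 1 := by
      rw [entry, matrixUnit, InnerProductSpace.rankOne_apply, inner_smul_right, inner_delta,
        delta_apply_self, one_mul]
    rwa [show entry E.1 o o = 1 from h1, one_smul] at this
  have hmul : ∀ v : V, (F v : BX X) = c • v.1 := fun v => ext_entry fun x y => by
    have := key v x y
    rw [hE, smul_smul] at this
    rw [entry_smul, mul_comm, smul_left_injective ℂ (matrixUnit_ne_zero o o) this]
  have hc0 : c ≠ 0 := by
    intro h0
    have h1 : F E = F 0 := Subtype.ext (by rw [hmul, hmul, h0, zero_smul, zero_smul])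
    exact matrixUnit_ne_zero o o (congrArg Subtype.val (φ.toEquiv.injective h1))
  intro T hT
  have := W.smul_mem c⁻¹ (F ⟨T, hT⟩).2
  rwa [hmul, smul_smul, inv_mul_cancel₀ hc0, one_smul] at this

theorem eq_of_mk_concreteBimodule_eq {s : StarSubalgebra ℂ (BX X)}
    [hs : IsClosed (s : Set (BX X))] {V W : Submodule ℂ (BX X)} (hV : IsConcreteBimodule s V)
    (hW : IsConcreteBimodule s W) (hsu : ∀ x y, matrixUnit x y ∈ s)
    (hVu : ∀ x, matrixUnit x x ∈ V) (hWu : ∀ x, matrixUnit x x ∈ W)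
    (h : S.mk (concreteBimodule hV) = S.mk (concreteBimodule hW)) : V = W := by
  obtain ⟨φ⟩ := Quotient.exact h
  exact le_antisymm (le_of_iso_concreteBimodule hV hW hsu hVu φ)
    (le_of_iso_concreteBimodule hW hV hsu hWu φ.symm)

end operators

/-! ### Metrics on the double -/

section double

variable {X : Type u} {b m : MetricSpace X}

theorem DoubleMetric.cross_nonneg (d : DoubleMetric b) (x y : X) : 0 ≤ d.cross x y := by
  have := d.dist_le_left x x y
  rw [b.dist_self] at this
  linarith

/-- The metric on the double with a prescribed distance function between the two copies. -/
noncomputable def DoubleMetric.ofCross (b : MetricSpace X) (c : X → X → ℝ)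
    (cross_le_left : ∀ x z y, c x y ≤ b.dist x z + c z y)
    (cross_le_right : ∀ x z y, c x y ≤ c x z + b.dist z y)
    (dist_le_left : ∀ x z y, b.dist x z ≤ c x y + c z y)
    (dist_le_right : ∀ x z y, b.dist x z ≤ c y x + c y z)
    (separated : ∃ ε > 0, ∀ x y, ε ≤ c x y) : DoubleMetric b where
  metric :=
    { dist := fun p q =>
        if p.2 = q.2 then b.dist p.1 q.1 else if p.2 = 0 then c p.1 q.1 else c q.1 p.1
      dist_self := fun p => by simp
      dist_comm := by
        rintro ⟨x, i⟩ ⟨y, j⟩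
        fin_cases i <;> fin_cases j <;> simp [b.dist_comm x y]
      dist_triangle := by
        rintro ⟨x, i⟩ ⟨y, j⟩ ⟨z, k⟩
        have h1 := b.dist_triangle x y z
        have h2 := cross_le_left x y z
        have h3 := cross_le_left z y x
        have h4 := cross_le_right x y z
        have h5 := cross_le_right z y x
        have h6 := dist_le_left x z y
        have h7 := dist_le_right x z y
        rw [b.dist_comm z y] at h3
        rw [b.dist_comm y x] at h5
        fin_cases i <;> fin_cases j <;> fin_cases k <;> simp <;> linarith
      eq_of_dist_eq_zero := by
        rintro ⟨x, i⟩ ⟨y, j⟩ h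
        obtain ⟨ε, hε, hc⟩ := separated
        have h1 := hc x y
        have h2 := hc y x
        fin_cases i <;> fin_cases j <;> simp at h ⊢
        · exact h
        · linarith
        · linarith
        · exact h }
  restrict i x y := if_pos rfl
  separated := separated

/-- The metric on the double with distance `b(x, y) + 1` between the copies. -/
noncomputable def DoubleMetric.cylinder (b : MetricSpace X) : DoubleMetric b :=
  .ofCross b (fun x y => b.dist x y + 1)
    (fun x z y => by linarith [b.dist_triangle x z y])
    (fun x z y => by linarith [b.dist_triangle x z y])
    (fun x z y => by linarith [b.dist_triangle x y z, b.dist_comm y z])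
    (fun x z y => by linarith [b.dist_triangle x y z, b.dist_comm x y])
    ⟨1, one_pos, fun x y => by
      have : 0 ≤ b.dist x y := dist_nonneg
      linarith⟩

/-- The maximum of two metrics on the double. -/
noncomputable def DoubleMetric.sup (d d' : DoubleMetric b) : DoubleMetric b :=
  .ofCross b (fun x y => max (d.cross x y) (d'.cross x y))
    (fun x z y => max_le ((d.cross_le_left x z y).trans (by gcongr; exact le_max_left _ _))
      ((d'.cross_le_left x z y).trans (by gcongr; exact le_max_right _ _)))
    (fun x z y => max_le ((d.cross_le_right x z y).trans (by gcongr; exact le_max_left _ _))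
      ((d'.cross_le_right x z y).trans (by gcongr; exact le_max_right _ _)))
    (fun x z y => (d.dist_le_left x z y).trans (by gcongr <;> exact le_max_left _ _))
    (fun x z y => (d.dist_le_right x z y).trans (by gcongr <;> exact le_max_left _ _))
    (by
      obtain ⟨ε, hε, h⟩ := d.separated
      exact ⟨ε, hε, fun x y => (h x y).trans (le_max_left _ _)⟩)

theorem finPropSubmodule_sup (d d' : DoubleMetric b) :
    finPropSubmodule (d.sup d').cross = finPropSubmodule d.cross ⊓ finPropSubmodule d'.cross := by
  refine le_antisymm (le_inf ?_ ?_) ?_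
  · exact finPropSubmodule_le fun L => ⟨L, fun x y h => (le_max_left _ _).trans h⟩
  · exact finPropSubmodule_le fun L => ⟨L, fun x y h => (le_max_right _ _).trans h⟩
  · rintro T ⟨⟨L, h⟩, ⟨L', h'⟩⟩
    refine ⟨max L L', fun x y hxy => ?_⟩
    rcases lt_max_iff.1 hxy with h1 | h1
    · exact h x y ((le_max_left _ _).trans_lt h1)
    · exact h' x y ((le_max_right _ _).trans_lt h1)

theorem finPropSubmodule_cylinder (b : MetricSpace X) :
    finPropSubmodule (DoubleMetric.cylinder b).cross = finPropSubmodule b.dist := by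
  refine le_antisymm (finPropSubmodule_le fun L => ⟨L, fun x y h => ?_⟩)
    (finPropSubmodule_le fun L => ⟨L + 1, fun x y h => ?_⟩)
  · change b.dist x y + 1 ≤ L at h
    linarith
  · change b.dist x y + 1 ≤ L + 1
    linarith

theorem finPropSubmodule_eq {m b : MetricSpace X} (h : CoarselyEquivalent m b) :
    finPropSubmodule m.dist = finPropSubmodule b.dist :=
  le_antisymm (finPropSubmodule_le fun L => (h.symm.bound L))
    (finPropSubmodule_le fun L => (h.bound L))

theorem finPropSubmodule_le_roeModule (d : DoubleMetric b) :
    finPropSubmodule d.cross ≤ roeModule d := Submodule.le_topologicalClosure _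

theorem roeModule_congr {d : DoubleMetric b} {d' : DoubleMetric m}
    (h : finPropSubmodule d.cross = finPropSubmodule d'.cross) : roeModule d = roeModule d' :=
  congrArg Submodule.topologicalClosure h

/-- Inclusion of the closures of the spaces of finite propagation operators controls the metrics: on a
violating sequence of pairs with distinct entries, the partial isometry matching them lies in the first
space at distance at least `1` from the second. -/
theorem cross_bound_of_roeModule_le (h : CoarselyEquivalent m b) {d : DoubleMetric b}
    {d' : DoubleMetric m} (hle : roeModule d ≤ roeModule d') (L : ℝ) :
    ∃ L', ∀ x y, d.cross x y ≤ L → d'.cross x y ≤ L' := by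
  classical
  by_contra! hcon
  -- Among the pairs involving a fixed point, `d'` is bounded, as `m` and `b` are coarsely equivalent.
  have hfib : ∀ z : X, ∃ K, ∀ x y, (x = z ∨ y = z) → d.cross x y ≤ L → d'.cross x y ≤ K := by
    intro z
    obtain ⟨K₀, hK₀⟩ := h.bound (L + L)
    have h1 : ∃ K, ∀ y, d.cross z y ≤ L → d'.cross z y ≤ K := by
      by_cases he : ∃ y₀, d.cross z y₀ ≤ L
      · obtain ⟨y₀, hy₀⟩ := he
        refine ⟨d'.cross z y₀ + K₀, fun y hy => ?_⟩
        have := hK₀ y₀ y ((d.dist_le_right y₀ y z).trans (by linarith))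
        linarith [d'.cross_le_right z y₀ y]
      · push Not at he
        exact ⟨0, fun y hy => absurd hy (he y).not_ge⟩
    have h2 : ∃ K, ∀ x, d.cross x z ≤ L → d'.cross x z ≤ K := by
      by_cases he : ∃ x₀, d.cross x₀ z ≤ L
      · obtain ⟨x₀, hx₀⟩ := he
        refine ⟨K₀ + d'.cross x₀ z, fun x hx => ?_⟩
        have := hK₀ x x₀ ((d.dist_le_left x x₀ z).trans (by linarith))
        linarith [d'.cross_le_left x x₀ z]
      · push Not at he
        exact ⟨0, fun x hx => absurd hx (he x).not_ge⟩
    obtain ⟨K, hK⟩ := h1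
    obtain ⟨K', hK'⟩ := h2
    refine ⟨max K K', ?_⟩
    rintro x y (rfl | rfl) hxy
    · exact (hK y hxy).trans (le_max_left _ _)
    · exact (hK' x hxy).trans (le_max_right _ _)
  choose K hK using hfib
  -- Avoiding any finite set of points, there are still pairs violating the bound.
  have hstep : ∀ (F : Finset X) (N : ℝ), ∃ p : X × X,
      (p.1 ∉ F ∧ p.2 ∉ F) ∧ d.cross p.1 p.2 ≤ L ∧ N < d'.cross p.1 p.2 := by
    intro F N
    obtain ⟨M, hM⟩ := (F.image K).bddAbove
    obtain ⟨x, y, h1, h2⟩ := hcon (max N M)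
    have hz : ∀ z ∈ F, x ≠ z ∧ y ≠ z := fun z hz => by
      have hz' : K z ≤ M := hM (by simpa using ⟨z, hz, rfl⟩)
      constructor <;> intro he
      · exact (h2.trans_le ((hK z x y (.inl he) h1).trans hz')).not_ge (le_max_right _ _)
      · exact (h2.trans_le ((hK z x y (.inr he) h1).trans hz')).not_ge (le_max_right _ _)
    exact ⟨(x, y), ⟨fun hx => (hz x hx).1 rfl, fun hy => (hz y hy).2 rfl⟩, h1,
      (le_max_left _ _).trans_lt h2⟩
  choose P hP hPL hPN using hstep
  let G : ℕ → Finset X := fun n => Nat.rec ∅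
    (fun n F => insert (P F n).1 (insert (P F n).2 F)) n
  let p : ℕ → X × X := fun n => P (G n) n
  have hGs : ∀ n, G (n + 1) = insert (p n).1 (insert (p n).2 (G n)) := fun n => rfl
  have hGmono : Monotone G := monotone_nat_of_le_succ fun n => by
    rw [hGs]
    exact (Finset.subset_insert _ _).trans (Finset.subset_insert _ _)
  have hmem : ∀ i j, i < j → (p i).1 ∈ G j ∧ (p i).2 ∈ G j := fun i j hij => by
    have := hGmono (Nat.succ_le_of_lt hij)
    constructor <;> refine this ?_ <;> simp [hGs]
  -- The index set is lifted because `delta` and `partialShift` keep to one universe.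
  let f : ULift.{u} ℕ → X := fun n => (p n.down).1
  let g : ULift.{u} ℕ → X := fun n => (p n.down).2
  have hf : Function.Injective f := by
    rintro ⟨i⟩ ⟨j⟩ he
    change (p i).1 = (p j).1 at he
    rcases lt_trichotomy i j with hij | rfl | hij
    · exact absurd (show (p j).1 ∈ G j from he ▸ (hmem i j hij).1) (hP (G j) j).1
    · rfl
    · exact absurd (show (p i).1 ∈ G i from he.symm ▸ (hmem j i hij).1) (hP (G i) i).1
  have hg : Function.Injective g := by
    rintro ⟨i⟩ ⟨j⟩ he
    change (p i).2 = (p j).2 at he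
    rcases lt_trichotomy i j with hij | rfl | hij
    · exact absurd (show (p j).2 ∈ G j from he ▸ (hmem i j hij).2) (hP (G j) j).2
    · rfl
    · exact absurd (show (p i).2 ∈ G i from he.symm ▸ (hmem j i hij).2) (hP (G i) i).2
  have hT : partialShift hf hg ∈ roeModule d := finPropSubmodule_le_roeModule d
    ⟨L, hasPropagation_partialShift hf hg fun n => hPL _ _⟩
  have hT' : partialShift hf hg ∈ closure (finPropSubmodule d'.cross : Set (BX X)) := hle hT
  obtain ⟨T, ⟨N, hN⟩, hTd⟩ := Metric.mem_closure_iff.1 hT' 1 one_pos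
  obtain ⟨n, hn⟩ := exists_nat_ge N
  have h1 := hN (f ⟨n⟩) (g ⟨n⟩) (hn.trans_lt (hPN (G n) n))
  have h2 := norm_entry_le (partialShift hf hg - T) (f ⟨n⟩) (g ⟨n⟩)
  rw [entry_sub, h1, sub_zero, entry_partialShift_apply, norm_one, ← dist_eq_norm] at h2
  exact h2.not_gt hTd

theorem finPropSubmodule_eq_of_roeModule_eq (h : CoarselyEquivalent m b) {d : DoubleMetric b}
    {d' : DoubleMetric m} (he : roeModule d = roeModule d') :
    finPropSubmodule d.cross = finPropSubmodule d'.cross :=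
  le_antisymm (finPropSubmodule_le (cross_bound_of_roeModule_le h he.le))
    (finPropSubmodule_le (cross_bound_of_roeModule_le h.symm he.ge))

end double

/-! ### Modules realized by all coarsely equivalent metrics -/

section universal

variable {X : Type u} {m b : MetricSpace X}

/-- The metric `m(x, y) + |h(x) - h(y)|`. -/
noncomputable abbrev addAbs (m : MetricSpace X) (h : X → ℝ) : MetricSpace X where
  dist x y := m.dist x y + |h x - h y|
  dist_self x := by simp
  dist_comm x y := by rw [m.dist_comm, abs_sub_comm]
  dist_triangle x y z := by
    linarith [m.dist_triangle x y z, abs_sub_le (h x) (h y) (h z)]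
  eq_of_dist_eq_zero {x y} hxy := by
    have h1 : 0 ≤ m.dist x y := dist_nonneg
    have h2 := abs_nonneg (h x - h y)
    exact m.eq_of_dist_eq_zero (by linarith)

theorem coarselyEquivalent_addAbs {h : X → ℝ} (hh : ∀ x y, |h x - h y| ≤ m.dist x y) :
    CoarselyEquivalent (addAbs m h) m := by
  refine ⟨Homeomorph.mulLeft₀ 2 two_ne_zero, fun x y => ⟨(symm_le_iff _ _ _).2 ?_, ?_⟩⟩
  · refine NNReal.coe_le_coe.1 ?_
    change m.dist x y ≤ 2 * (m.dist x y + |h x - h y|)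
    have h1 : 0 ≤ m.dist x y := dist_nonneg
    linarith [abs_nonneg (h x - h y)]
  · refine NNReal.coe_le_coe.1 ?_
    change m.dist x y + |h x - h y| ≤ 2 * m.dist x y
    linarith [hh x y]

theorem DoubleMetric.dist_le_left' (d : DoubleMetric b) (x y z w : X) :
    b.dist x z ≤ d.cross x y + b.dist y w + d.cross z w := by
  linarith [d.dist_le_left x z w, d.cross_le_right x y w]

theorem DoubleMetric.dist_le_right' (d : DoubleMetric b) (x y z w : X) :
    b.dist y w ≤ d.cross x y + b.dist x z + d.cross z w := by
  linarith [d.dist_le_right y w z, d.cross_le_left z x y, b.dist_comm x z]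

/-- `V` is, for each metric coarsely equivalent to `m`, the space of finite propagation operators of
some metric on the double. -/
def IsUniversal (m : MetricSpace X) (V : Submodule ℂ (BX X)) : Prop :=
  ∀ b, CoarselyEquivalent b m → ∃ d : DoubleMetric b, finPropSubmodule d.cross = V

theorem IsUniversal.congr {V : Submodule ℂ (BX X)} (hV : IsUniversal m V)
    (h : CoarselyEquivalent m b) : IsUniversal b V :=
  fun b' h' => hV b' (h'.trans h.symm)

theorem IsUniversal.inf {V W : Submodule ℂ (BX X)} (hV : IsUniversal m V) (hW : IsUniversal m W) :
    IsUniversal m (V ⊓ W) := by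
  intro b h
  obtain ⟨d, rfl⟩ := hV b h
  obtain ⟨d', rfl⟩ := hW b h
  exact ⟨d.sup d', finPropSubmodule_sup d d'⟩

theorem isUniversal_finProp (m : MetricSpace X) : IsUniversal m (finPropSubmodule m.dist) :=
  fun b h => ⟨.cylinder b, (finPropSubmodule_cylinder b).trans (finPropSubmodule_eq h)⟩

/-- A universal space consists of operators of finite propagation on `X`. Otherwise there are pairs
`(x_k, y_k)` at bounded distance across the double with `m(x_k, y_k) → ∞`; after adding
`|h(x) - h(y)|` to `m`, where `h` is the distance to the set of all `y_k`, no metric on the double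
can match `x_k` with `y_k` any more. -/
theorem IsUniversal.dist_bound {d : DoubleMetric m} (hd : IsUniversal m (finPropSubmodule d.cross))
    (L : ℝ) : ∃ K, ∀ x y, d.cross x y ≤ L → m.dist x y ≤ K := by
  by_contra! hcon
  obtain ⟨o, o', ho, hoo⟩ := hcon 0
  have hL : 0 ≤ L := (d.cross_nonneg o o').trans ho
  set C := 2 * L + m.dist o o' with hC
  have hC0 : 0 ≤ C := by positivity
  have hS : ∀ x y, d.cross x y ≤ L →
      m.dist x o ≤ m.dist y o + C ∧ m.dist y o ≤ m.dist x o + C := fun x y h => by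
    have h1 := d.dist_le_left' x y o o'
    have h2 := d.dist_le_right' x y o o'
    have h3 := m.dist_triangle y o o'
    have h4 := m.dist_triangle y o' o
    have h5 := m.dist_comm o o'
    constructor <;> linarith
  -- Violating pairs are also far from `o`, so a sequence of them can be chosen whose distance from `o`
  -- grows so fast that each `x_k` is far from all the `y_j`.
  have hstep : ∀ N : ℝ, ∃ p : X × X, d.cross p.1 p.2 ≤ L ∧ N ≤ m.dist p.1 p.2 ∧
      N ≤ m.dist p.1 o := by
    intro N
    obtain ⟨x, y, h1, h2⟩ := hcon (2 * max N 0 + C)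
    have h3 := m.dist_triangle x o y
    rw [m.dist_comm o y] at h3
    have h4 := (hS x y h1).2
    have h5 := le_max_left N 0
    have h6 := le_max_right N 0
    exact ⟨(x, y), h1, by simp only; linarith, by simp only; linarith⟩
  choose P hPL hPd hPo using hstep
  let q : ℕ → X × X := fun n => Nat.rec (P 0)
    (fun n p => P (max (n + 1) (m.dist p.1 o + C + (n + 1)))) n
  have hq : ∀ n, q (n + 1) = P (max (n + 1) (m.dist (q n).1 o + C + (n + 1))) := fun n => rfl
  have hqL : ∀ n, d.cross (q n).1 (q n).2 ≤ L := fun n => by cases n <;> exact hPL _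
  have hqd : ∀ n : ℕ, (n : ℝ) ≤ m.dist (q n).1 (q n).2 := fun n => by
    cases n with
    | zero => rw [Nat.cast_zero]; exact hPd 0
    | succ n => rw [hq]; push_cast; exact (le_max_left _ _).trans (hPd _)
  have hqo : ∀ n : ℕ, m.dist (q n).1 o + C + (n + 1) ≤ m.dist (q (n + 1)).1 o := fun n => by
    rw [hq]; exact (le_max_right _ _).trans (hPo _)
  have hmono : Monotone fun n => m.dist (q n).1 o := monotone_nat_of_le_succ fun n => by
    have : (0 : ℝ) ≤ n := n.cast_nonneg
    linarith [hqo n]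
  have hlt : ∀ j k : ℕ, j < k → m.dist (q j).1 o + C + k ≤ m.dist (q k).1 o := fun j k h => by
    obtain ⟨k, rfl⟩ : ∃ l, k = l + 1 := ⟨k - 1, by omega⟩
    have h1 : m.dist (q j).1 o ≤ m.dist (q k).1 o := hmono (Nat.lt_succ_iff.1 h)
    have h2 := hqo k
    push_cast
    linarith
  have hfar : ∀ j k : ℕ, (k : ℝ) ≤ m.dist (q k).1 (q j).2 := fun j k => by
    rcases lt_trichotomy j k with h | rfl | h
    · linarith [hlt j k h, (hS _ _ (hqL j)).2, m.dist_triangle (q k).1 (q j).2 o]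
    · exact hqd j
    · have h1 : (k : ℝ) ≤ j := by exact_mod_cast h.le
      linarith [hlt k j h, (hS _ _ (hqL j)).1, m.dist_triangle (q j).2 (q k).1 o,
        m.dist_comm (q k).1 (q j).2]
  let _ := m
  let B : Set X := Set.range fun n => (q n).2
  let h : X → ℝ := fun x => Metric.infDist x B
  have hh : ∀ x y, |h x - h y| ≤ m.dist x y := fun x y =>
    abs_sub_le_iff.2 ⟨by
      have : h x ≤ h y + m.dist x y := Metric.infDist_le_infDist_add_dist
      linarith, by
      have : h y ≤ h x + m.dist y x := Metric.infDist_le_infDist_add_dist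
      linarith [m.dist_comm x y]⟩
  have hy : ∀ k, h (q k).2 = 0 := fun k => Metric.infDist_zero_of_mem ⟨k, rfl⟩
  have hx : ∀ k : ℕ, (k : ℝ) ≤ h (q k).1 := fun k => by
    have hne : B.Nonempty := ⟨_, 0, rfl⟩
    refine (Metric.le_infDist hne).2 ?_
    rintro _ ⟨j, rfl⟩
    exact hfar j k
  have hce := coarselyEquivalent_addAbs hh
  obtain ⟨d', hd'⟩ := hd _ hce
  obtain ⟨L', hL'⟩ := cross_bound_of_roeModule_le hce (roeModule_congr hd'.symm).le L
  obtain ⟨k, hk⟩ := exists_nat_gt (2 * L' + 2 * L + |h o'| + h o)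
  have h1 : m.dist (q k).1 o + |h (q k).1 - h o| ≤ d'.cross (q k).1 (q k).2
      + (m.dist (q k).2 o' + |h (q k).2 - h o'|) + d'.cross o o' :=
    d'.dist_le_left' (q k).1 (q k).2 o o'
  rw [hy, zero_sub, abs_neg] at h1
  linarith [hL' _ _ (hqL k), hL' _ _ ho, d.dist_le_right' (q k).1 (q k).2 o o', hqL k, hx k,
    le_abs_self (h (q k).1 - h o)]

/-! ### The classes `[M_d(X)]` and their products -/

theorem isConcreteBimodule_roe (h : CoarselyEquivalent b m) (d : DoubleMetric b) :
    IsConcreteBimodule (uniformRoe m) (roeModule d) := by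
  rw [← uniformRoe_eq h]
  exact ⟨isClosed_roeModule d, fun _ ha _ hm => mul_mem_roeModule d ha hm,
    fun _ ha _ hm => mul_mem_roeModule' d ha hm, fun _ hv _ hw => mul_star_mem d hv hw,
    fun _ hv _ hw => star_mul_mem d hv hw⟩

theorem mk_roeBimodule (d : DoubleMetric b) :
    S.mk (roeBimodule d) = S.mk (concreteBimodule (isConcreteBimodule_roe (.refl b) d)) := rfl

theorem matrixUnit_mem_uniformRoe (m : MetricSpace X) (x y : X) : matrixUnit x y ∈ uniformRoe m :=
  mem_uniformRoe.2 (subset_closure ⟨_, hasPropagation_matrixUnit m.dist x y⟩)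

theorem matrixUnit_mem_roeModule (d : DoubleMetric b) (x y : X) : matrixUnit x y ∈ roeModule d :=
  finPropSubmodule_le_roeModule d ⟨_, hasPropagation_matrixUnit d.cross x y⟩

theorem transport_mk_roeBimodule_eq_iff (h : CoarselyEquivalent b m) (d : DoubleMetric b)
    (d' : DoubleMetric m) :
    S.transport (uniformRoe_eq h) (S.mk (roeBimodule d)) = S.mk (roeBimodule d') ↔
      finPropSubmodule d.cross = finPropSubmodule d'.cross := by
  rw [mk_roeBimodule, mk_roeBimodule, transport_mk_concreteBimodule _ _
    (isConcreteBimodule_roe h d) rfl]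
  constructor
  · intro he
    exact finPropSubmodule_eq_of_roeModule_eq h.symm
      (eq_of_mk_concreteBimodule_eq _ _ (matrixUnit_mem_uniformRoe m)
        (fun x => matrixUnit_mem_roeModule d x x) (fun x => matrixUnit_mem_roeModule d' x x) he)
  · intro he
    exact mk_concreteBimodule_congr _ _ (roeModule_congr he)

theorem mk_roeBimodule_eq_iff (d d' : DoubleMetric m) :
    S.mk (roeBimodule d) = S.mk (roeBimodule d') ↔
      finPropSubmodule d.cross = finPropSubmodule d'.cross :=
  transport_mk_roeBimodule_eq_iff (.refl m) d d'

theorem mem_Mc_iff {s : S (uniformRoe m)} :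
    s ∈ Mc m ↔ ∃ d : DoubleMetric m, IsUniversal m (finPropSubmodule d.cross) ∧
      S.mk (roeBimodule d) = s := by
  rw [Mc, Set.mem_iInter₂]
  constructor
  · intro hs
    obtain ⟨_, ⟨c, rfl⟩, rfl⟩ := hs m (.refl m)
    induction c using Quotient.inductionOn with | _ d
    refine ⟨d, fun b h => ?_, rfl⟩
    obtain ⟨_, ⟨c, rfl⟩, he⟩ := hs b h
    induction c using Quotient.inductionOn with | _ d'
    exact ⟨d', (transport_mk_roeBimodule_eq_iff h d' d).1 he⟩
  · rintro ⟨d, hd, rfl⟩ b h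
    obtain ⟨d', hd'⟩ := hd b h
    exact ⟨_, ⟨Quotient.mk _ d', rfl⟩, (transport_mk_roeBimodule_eq_iff h d' d).2 hd'⟩

/-- The product of two universal classes is given by the intersection: for universal spaces, an operator
of finite propagation for both metrics is supported on a set on which both metrics stay close to the
diagonal, and multiplying by the projection onto this set exhibits it as a product. -/
theorem mk_mul_mk_roeBimodule {d d' : DoubleMetric m}
    (hd : IsUniversal m (finPropSubmodule d.cross))
    (hd' : IsUniversal m (finPropSubmodule d'.cross)) :
    S.mk (roeBimodule d) * S.mk (roeBimodule d') = S.mk (roeBimodule (d.sup d')) := by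
  simp only [mk_roeBimodule]
  refine mk_mul_mk_concreteBimodule _ _ _ ?_ ?_
  · intro v hv w hw
    refine map_mem_closure₂ continuous_mul hv hw ?_
    rintro T ⟨L, hT⟩ T' ⟨L', hT'⟩
    obtain ⟨K, hK⟩ := hd.dist_bound L
    obtain ⟨K', hK'⟩ := hd'.dist_bound L'
    have hm : HasPropagation m.dist K T := fun x y h => hT x y (lt_of_not_ge fun hc =>
      (hK x y hc).not_gt h)
    have hm' : HasPropagation m.dist K' T' := fun x y h => hT' x y (lt_of_not_ge fun hc =>
      (hK' x y hc).not_gt h)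
    rw [finPropSubmodule_sup]
    exact ⟨⟨L + K', hT.mul hm' d.cross_le_left⟩, ⟨K + L', hm.mul hT' d'.cross_le_right⟩⟩
  · refine closure_mono ?_
    rintro T ⟨L, hT⟩
    obtain ⟨K, hK⟩ := hd.dist_bound L
    let A : Set X := {x | d.cross x x ≤ L + K ∧ d'.cross x x ≤ L + K}
    have hTA : T * proj A = T := by
      refine mul_proj_eq fun x y hx => hT x y (lt_of_not_ge fun hc => hx ?_)
      have h1 : d.cross x y ≤ L := (le_max_left _ _).trans hc
      have h2 : d'.cross x y ≤ L := (le_max_right _ _).trans hc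
      have h3 := hK x y h1
      rw [m.dist_comm] at h3
      exact ⟨by linarith [d.cross_le_right x y x], by linarith [d'.cross_le_right x y x]⟩
    rw [SetLike.mem_coe, ← hTA]
    refine Submodule.subset_span ⟨T, ?_, proj A, ?_, rfl⟩
    · exact finPropSubmodule_le_roeModule d
        ⟨L, fun x y h => hT x y (h.trans_le (le_max_left _ _))⟩
    · exact finPropSubmodule_le_roeModule d'
        ⟨L + K, hasPropagation_partialShift _ _ fun x => x.2.2⟩

theorem isInverseSubsemigroup_Mc (m : MetricSpace X) : IsInverseSubsemigroup (Mc m) where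
  nonempty := ⟨_, mem_Mc_iff.2 ⟨.cylinder m, by
    rw [finPropSubmodule_cylinder]; exact isUniversal_finProp m, rfl⟩⟩
  mul_mem := by
    intro x hx y hy
    obtain ⟨d, hd, rfl⟩ := mem_Mc_iff.1 hx
    obtain ⟨d', hd', rfl⟩ := mem_Mc_iff.1 hy
    refine mem_Mc_iff.2 ⟨d.sup d', ?_, (mk_mul_mk_roeBimodule hd hd').symm⟩
    rw [finPropSubmodule_sup]
    exact hd.inf hd'
  mul_assoc := by
    intro x hx y hy z hz
    obtain ⟨d₁, h₁, rfl⟩ := mem_Mc_iff.1 hx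
    obtain ⟨d₂, h₂, rfl⟩ := mem_Mc_iff.1 hy
    obtain ⟨d₃, h₃, rfl⟩ := mem_Mc_iff.1 hz
    have h₁₂ := finPropSubmodule_sup d₁ d₂ ▸ h₁.inf h₂
    have h₂₃ := finPropSubmodule_sup d₂ d₃ ▸ h₂.inf h₃
    rw [mk_mul_mk_roeBimodule h₁ h₂, mk_mul_mk_roeBimodule h₂ h₃, mk_mul_mk_roeBimodule h₁₂ h₃,
      mk_mul_mk_roeBimodule h₁ h₂₃, mk_roeBimodule_eq_iff]
    simp only [finPropSubmodule_sup, inf_assoc]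
  exists_unique_inv := by
    -- Each element is its own inverse, and `V ⊓ W ⊓ V = V`, `W ⊓ V ⊓ W = W` force `V = W`.
    have key : ∀ d d' : DoubleMetric m, IsUniversal m (finPropSubmodule d.cross) →
        IsUniversal m (finPropSubmodule d'.cross) →
        (S.mk (roeBimodule d) * S.mk (roeBimodule d') * S.mk (roeBimodule d)
          = S.mk (roeBimodule d) ↔ finPropSubmodule d.cross ≤ finPropSubmodule d'.cross) := by
      intro d d' hd hd'
      have h := finPropSubmodule_sup d d' ▸ hd.inf hd'
      rw [mk_mul_mk_roeBimodule hd hd', mk_mul_mk_roeBimodule h hd, mk_roeBimodule_eq_iff,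
        finPropSubmodule_sup, finPropSubmodule_sup, inf_right_comm, inf_idem, inf_eq_left]
    intro x hx
    obtain ⟨d, hd, rfl⟩ := mem_Mc_iff.1 hx
    refine ⟨_, ⟨hx, (key d d hd hd).2 le_rfl, (key d d hd hd).2 le_rfl⟩, ?_⟩
    rintro y ⟨hy, h1, h2⟩
    obtain ⟨d', hd', rfl⟩ := mem_Mc_iff.1 hy
    exact (mk_roeBimodule_eq_iff d' d).2
      (le_antisymm ((key d' d hd' hd).1 h2) ((key d d' hd hd').1 h1))

theorem transport_image_Mc (h : CoarselyEquivalent m b) :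
    S.transport (uniformRoe_eq h) '' Mc m = Mc b := by
  ext s
  rw [mem_Mc_iff]
  constructor
  · rintro ⟨s, hs, rfl⟩
    obtain ⟨d, hd, rfl⟩ := mem_Mc_iff.1 hs
    obtain ⟨d', hd'⟩ := hd b h.symm
    exact ⟨d', hd' ▸ hd.congr h, ((transport_mk_roeBimodule_eq_iff h d d').2 hd'.symm).symm⟩
  · rintro ⟨d, hd, rfl⟩
    obtain ⟨d', hd'⟩ := hd m h
    exact ⟨_, mem_Mc_iff.2 ⟨d', hd' ▸ hd.congr h.symm, rfl⟩,
      (transport_mk_roeBimodule_eq_iff h d' d).2 hd'⟩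

end universal

end RoeBimodule

theorem mainTheorem4 {X : Type*} [Countable X] [dX : MetricSpace X] [DiscreteTopology X] :
    RoeBimodule.IsInverseSubsemigroup (RoeBimodule.Mc dX) ∧
      ∀ (b : MetricSpace X) (h : RoeBimodule.CoarselyEquivalent dX b),
        RoeBimodule.S.transport (RoeBimodule.uniformRoe_eq h) '' RoeBimodule.Mc dX =
          RoeBimodule.Mc b :=
  ⟨RoeBimodule.isInverseSubsemigroup_Mc dX, fun _ h => RoeBimodule.transport_image_Mc h⟩
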